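/- Fix partitions $\mu_1,\mu_2,\mu_3$, each identified with the set of coordinates $(u,v)\in\mathbb Z_{\ge0}^2$ of the boxes of its Young diagram, with corner at $(0,0)$. Put $$\mathrm{Cyl}_1=\{(x,u,v)\in\mathbb Z^3:(u,v)\in\mu_1\},\quad \mathrm{Cyl}_2=\{(v,y,u)\in\mathbb Z^3:(u,v)\in\mu_2\},\quad \mathrm{Cyl}_3=\{(u,v,z)\in\mathbb Z^3:(u,v)\in\mu_3\},$$ $\mathrm{Cyl}_i^-=\mathrm{Cyl}_i\setminus\mathbb Z^3_{\ge0}$, $\mathrm I^-=\mathrm{Cyl}_1^-\cup\mathrm{Cyl}_2^-\cup\mathrm{Cyl}_3^-$, $\mathrm{II}_{\bar i}=(\mathrm{Cyl}_j\cap\mathrm{Cyl}_k)\setminus\mathrm{Cyl}_i$ for $\{i,j,k\}=\{1,2,3\}$, $\mathrm{II}=\mathrm{II}_{\bar1}\cup\mathrm{II}_{\bar2}\cup\mathrm{II}_{\bar3}$, and $\mathrm{III}=\mathrm{Cyl}_1\cap\mathrm{Cyl}_2\cap\mathrm{Cyl}_3$. An $AB$ configuration is a pair of finite sets $A\subseteq\mathrm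 I^-\cup\mathrm{III}$, $B\subseteq\mathrm{II}\cup\mathrm{III}$ such that every $w\in\mathrm I^-\cup\mathrm{III}$ (resp. $w\in\mathrm{II}\cup\mathrm{III}$) with $w-e_i\in A$ (resp. $w-e_i\in B$) for some unit vector $e_i$ lies in $A$ (resp. $B$). It is a labelled $AB$ configuration if the box labelling algorithm succeeds on it, that is, if no connected component (boxes being adjacent when they share a face) of $$(\mathrm I^-\cap A)\cup(\mathrm{II}\setminus B)\cup(\mathrm{III}\cap(A\triangle B))$$ contains a box of $\mathrm{Cyl}_i^-\cup\mathrm{II}_{\bar i}$ and a box of $\mathrm{Cyl}_j^-\cup\mathrm{II}_{\bar j}$ for some $i\ne j$. Project $\mathbb Z^3$ along $(1,1,1)$ to the triangular lattice, and let $H$ be the infinite honeycomb graph dual to it. The surface of a down-closed set of boxes $J\subseteq\mathbb Z^3$, seen from direction $(1,1,1)$, is a tiling of the plane by lozenges, that is, a dimer configuration of $H$: a lozenge, the union of two triangles with a common side, gives the edge of $H$ that joins these two triangles. Let $M_A$ be the dimer configuration from the surface of $(\mathrm I^-\cup\mathrm{III})\setminus A$ together with all boxes with at least two negative coordinates, let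 $M_B$ be the one from the surface of $(\mathrm{II}\cup\mathrm{III})\setminus B$ together with all boxes with at least one negative coordinate, and let the double-dimer configuration $D_{(A,B)}$ be the superposition of $M_A$ and $M_B$. A path of $D_{(A,B)}$ is a component that is a path infinite in both directions. The projections of the three positive coordinate axes divide the plane into three sectors. Let $(A,B)$ be an $AB$ configuration. Then $(A,B)$ is a labelled $AB$ configuration if and only if every path of $D_{(A,B)}$ starts and ends in the same sector, i.e. there is a sector that contains all but finitely many vertices of the path. -/

import Mathlib

open Filter

/-! ### Boxes, cylinders and regions -/

/-- A box (cell) is a point of `ℤ³`; the box `w` occupies the unit cube `w + [0,1]³`.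
The coordinates, the three partitions and the three labels are indexed cyclically by `Fin 3`. -/
abbrev Box : Type := Fin 3 → ℤ

/-- The unit vector in direction `i`. -/
def unitVec (i : Fin 3) : Box := Pi.single i 1

/-- The cylinder in direction `i` over the partition `μ i` (a Young diagram with corner at `(0,0)`):
`Cyl₁ = {(x,u,v)}`, `Cyl₂ = {(v,y,u)}`, `Cyl₃ = {(u,v,z)}` with `(u,v)` in `μ₁`, `μ₂`, `μ₃`. -/
def Cyl (μ : Fin 3 → YoungDiagram) (i : Fin 3) : Set Box :=
  {w | ∃ u v : ℕ, (u, v) ∈ μ i ∧ w (i + 1) = (u : ℤ) ∧ w (i + 2) = (v : ℤ)}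

/-- The first octant `ℤ³_{≥ 0}`. -/
def octant : Set Box := {w | ∀ i, 0 ≤ w i}

/-- `Cyl_i⁻ = Cyl_i \ ℤ³_{≥ 0}`. -/
def CylNeg (μ : Fin 3 → YoungDiagram) (i : Fin 3) : Set Box := Cyl μ i \ octant

/-- `I⁻ = Cyl₁⁻ ∪ Cyl₂⁻ ∪ Cyl₃⁻`. -/
def RegionINeg (μ : Fin 3 → YoungDiagram) : Set Box := ⋃ i, CylNeg μ i

/-- `II_ī`: the boxes in the two cylinders other than `Cyl_i`, but not in `Cyl_i`. -/
def RegionIIBar (μ : Fin 3 → YoungDiagram) (i : Fin 3) : Set Box :=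
  (Cyl μ (i + 1) ∩ Cyl μ (i + 2)) \ Cyl μ i

/-- `II`, the union of the three regions `II_ī`. -/
def RegionII (μ : Fin 3 → YoungDiagram) : Set Box := ⋃ i, RegionIIBar μ i

/-- `III = Cyl₁ ∩ Cyl₂ ∩ Cyl₃`. -/
def RegionIII (μ : Fin 3 → YoungDiagram) : Set Box := ⋂ i, Cyl μ i

/-! ### `AB` configurations and the box labelling algorithm -/

/-- The stacking condition inside a region `R`, gravity pulling in direction `(1,1,1)`: a cell of
`R` one of whose three predecessors supports a box of `S` supports a box of `S`. -/
def Stacked (R S : Set Box) : Prop :=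
  ∀ w ∈ R, (∃ i, w - unitVec i ∈ S) → w ∈ S

/-- `AB` configurations. -/
structure IsABConfiguration (μ : Fin 3 → YoungDiagram) (A B : Set Box) : Prop where
  finite_A : A.Finite
  finite_B : B.Finite
  subset_A : A ⊆ RegionINeg μ ∪ RegionIII μ
  subset_B : B ⊆ RegionII μ ∪ RegionIII μ
  stacked_A : Stacked (RegionINeg μ ∪ RegionIII μ) A
  stacked_B : Stacked (RegionII μ ∪ RegionIII μ) B

/-- Two boxes are adjacent if they share a face. -/
def boxGraph : SimpleGraph Box where
  Adj w w' := ∃ i, w' = w + unitVec i ∨ w = w' + unitVec i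
  symm := ⟨fun _ _ ⟨i, h⟩ => ⟨i, h.symm⟩⟩
  loopless := ⟨fun w ⟨i, h⟩ => by
    have h' : w = w + unitVec i := by rcases h with h | h <;> exact h
    have := congrFun h' i
    simp [unitVec] at this⟩

/-- The set `(I⁻ ∩ A) ∪ (II \ B) ∪ (III ∩ (A ∆ B))` of cells that the algorithm labels. -/
def labelledCells (μ : Fin 3 → YoungDiagram) (A B : Set Box) : Set Box :=
  (RegionINeg μ ∩ A) ∪ (RegionII μ \ B) ∪ (RegionIII μ ∩ symmDiff A B)

/-- The component `C` of the set of cells to be labelled contains a box of `Cyl_i⁻ ∪ II_ī`, so that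
the algorithm has to give the label `i` to `C`. -/
def ForcesLabel (μ : Fin 3 → YoungDiagram) (A B : Set Box)
    (C : (boxGraph.induce (labelledCells μ A B)).ConnectedComponent) (i : Fin 3) : Prop :=
  ∃ w ∈ C.supp, (w : Box) ∈ CylNeg μ i ∪ RegionIIBar μ i

/-- The box labelling algorithm terminates with failure exactly if some connected component of the
set of cells to be labelled has to get two different labels. -/
def BoxLabellingFails (μ : Fin 3 → YoungDiagram) (A B : Set Box) : Prop :=
  ∃ (C : (boxGraph.induce (labelledCells μ A B)).ConnectedComponent) (i j : Fin 3),
    i ≠ j ∧ ForcesLabel μ A B C i ∧ ForcesLabel μ A B C j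

/-- A labelled `AB` configuration is an `AB` configuration on which the box labelling algorithm
succeeds. -/
def IsLabelledABConfiguration (μ : Fin 3 → YoungDiagram) (A B : Set Box) : Prop :=
  IsABConfiguration μ A B ∧ ¬ BoxLabellingFails μ A B

/-! ### The infinite honeycomb graph -/

/-- Points of the triangular lattice `ℤ³ / ℤ(1,1,1)`. They are the faces of the honeycomb graph. -/
abbrev LatticePoint : Type := ℤ × ℤ

/-- The projection of `ℤ³` along `(1,1,1)` to the triangular lattice. -/
def proj (w : Box) : LatticePoint := (w 0 - w 2, w 1 - w 2)

/-- Vertices of the honeycomb graph `H`: the unit triangles of the triangular lattice. -/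
inductive HexVertex : Type
  | up (p : LatticePoint)
  | down (p : LatticePoint)

/-- The three corners of a unit triangle; `(1,0)`, `(0,1)`, `(-1,-1)` are the projections of the
three unit vectors of `ℤ³`. -/
def HexVertex.corners : HexVertex → Set LatticePoint
  | .up p => {p, p + (1, 0), p + (1, 1)}
  | .down p => {p, p + (0, 1), p + (1, 1)}

/-- The infinite honeycomb graph `H`, the dual of the triangular lattice: two different triangles
are adjacent if they share a side. -/
def honeycomb : SimpleGraph HexVertex where
  Adj s t := s ≠ t ∧ ∃ p q, p ≠ q ∧ p ∈ s.corners ∩ t.corners ∧ q ∈ s.corners ∩ t.corners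
  symm := ⟨fun _ _ ⟨h, p, q, hpq, hp, hq⟩ => ⟨h.symm, p, q, hpq, hp.symm, hq.symm⟩⟩
  loopless := ⟨fun _ h => h.1 rfl⟩

theorem proj_ne_proj_add_unitVec (w : Box) (i : Fin 3) : proj w ≠ proj (w + unitVec i) := by
  intro h
  have h1 := congrArg Prod.fst h
  have h2 := congrArg Prod.snd h
  fin_cases i <;> simp [proj, unitVec] at h1 h2

/-- The edges of `H` given by the surface of a solid `J ⊆ ℤ³`, seen from direction `(1,1,1)`.
Every visible unit square lies between a box `w ∈ J` and a box `w + e_i ∉ J`; it projects to the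
lozenge with short diagonal from `proj w` to `proj (w + e_i)`, that is, to the union of the two
triangles that share this side, and the lozenge corresponds to the edge of `H` that joins them. -/
def surfaceDimers (J : Set Box) : honeycomb.Subgraph where
  verts := Set.univ
  Adj s t := s ≠ t ∧ ∃ (w : Box) (i : Fin 3), w ∈ J ∧ w + unitVec i ∉ J ∧
    proj w ∈ s.corners ∩ t.corners ∧ proj (w + unitVec i) ∈ s.corners ∩ t.corners
  adj_sub := fun ⟨h, w, i, _, _, h1, h2⟩ =>
    ⟨h, proj w, proj (w + unitVec i), proj_ne_proj_add_unitVec w i, h1, h2⟩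
  edge_vert := fun _ => Set.mem_univ _
  symm := ⟨fun _ _ ⟨h, w, i, h1, h2, h3, h4⟩ => ⟨h.symm, w, i, h1, h2, h3.symm, h4.symm⟩⟩

/-! ### The double-dimer configuration of an `AB` configuration -/

/-- The solid whose surface extends the surface of `(I⁻ ∪ III) \ A` to a tiling of the whole plane:
the boxes with at least two negative coordinates are added. The added tiles lie on six quarter
planes, two for each of the regions `{x < 0, y ≥ 0, z ≥ 0}`, `{x ≥ 0, y < 0, z ≥ 0}`,
`{x ≥ 0, y ≥ 0, z < 0}`, which contain the three parts of `I⁻`. -/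
def solidA (μ : Fin 3 → YoungDiagram) (A : Set Box) : Set Box :=
  {w | ∃ i j, i ≠ j ∧ w i < 0 ∧ w j < 0} ∪ (RegionINeg μ ∪ RegionIII μ) \ A

/-- The solid whose surface extends the surface of `(II ∪ III) \ B` to a tiling of the whole plane:
the boxes outside the first octant are added, so that the added tiles lie on the three walls of the
octant. -/
def solidB (μ : Fin 3 → YoungDiagram) (B : Set Box) : Set Box :=
  octantᶜ ∪ (RegionII μ ∪ RegionIII μ) \ B

/-- The dimer configuration `M_A`. -/
def dimerA (μ : Fin 3 → YoungDiagram) (A : Set Box) : honeycomb.Subgraph :=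
  surfaceDimers (solidA μ A)

/-- The dimer configuration `M_B`. -/
def dimerB (μ : Fin 3 → YoungDiagram) (B : Set Box) : honeycomb.Subgraph :=
  surfaceDimers (solidB μ B)

/-- The double-dimer configuration `D_(A,B)`, the union of `M_A` and `M_B`. -/
def doubleDimer (μ : Fin 3 → YoungDiagram) (A B : Set Box) : honeycomb.Subgraph :=
  dimerA μ A ⊔ dimerB μ B

/-! ### Sectors and paths -/

/-- The closed cone of the triangular lattice spanned by the projections of the two positive
coordinate axes other than axis `i`. -/
def sectorPoints (i : Fin 3) : Set LatticePoint :=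
  {p | ∃ w : Box, p = proj w ∧ w i = 0 ∧ ∀ j, 0 ≤ w j}

/-- Sector `i` of `H`: the projections of the three positive coordinate axes cut the plane into
three sectors, and sector `i` is the one between the two axes other than axis `i`. -/
def sector (i : Fin 3) : Set HexVertex := {t | t.corners ⊆ sectorPoints i}

/-- A path of a double-dimer configuration. Two edges of the configuration, counted with
multiplicity, meet at every vertex, so a component is a doubled edge, a loop, or a path that is
infinite in both directions and passes through each of its vertices once. -/
structure IsPath (D : honeycomb.Subgraph) (γ : ℤ → HexVertex) : Prop where
  injective : Function.Injective γ
  adj : ∀ n, D.Adj (γ n) (γ (n + 1))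

/-- The path `γ` starts in sector `i`. -/
def StartsIn (γ : ℤ → HexVertex) (i : Fin 3) : Prop := ∀ᶠ n in atBot, γ n ∈ sector i

/-- The path `γ` ends in sector `i`. -/
def EndsIn (γ : ℤ → HexVertex) (i : Fin 3) : Prop := ∀ᶠ n in atTop, γ n ∈ sector i

/-- Every path of `D` starts and ends in the same sector. -/
def PathsStartAndEndInSameSector (D : honeycomb.Subgraph) : Prop :=
  ∀ γ, IsPath D γ → ∃ i, StartsIn γ i ∧ EndsIn γ i

/-! Both solids are lower sets of boxes, so their surfaces are graphs of height functions on the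
triangular lattice, `H` for `solidA` and `H'` for `solidB`. Across a side of the lattice `H' - H`
changes exactly when the dual edge lies in just one of the two matchings, and then by one. Hence the
paths of the double dimer are level lines of `H' - H` (`IsPath.exists_high_low`).

The set `solidB \ solidA` consists of the infinite `outerCells` of the three sectors and of labelled
cells. A labelled cell next to an outer cell of sector `i` must get the label `i`. So the labelling
succeeds exactly when no two sectors have their outer cells connected inside `solidB \ solidA`.

If it succeeds, the top boxes on the high side of a path are connected in this set
(`StepInvariant.top_eq`) and share one label. Far out they are outer cells, whose label is their
sector, so both ends lie in that sector.

Conversely, far along the common axis of two sectors, outer cells lie on both sides of a line where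
`H' ≤ H`. A path runs along this axis inside the first sector, and by assumption it also returns
there. It separates the outer cells of the two sectors. In place of a Jordan curve argument there is
a potential that jumps only across the path (`exists_potential_of_closed`): it is constant on
connected parts of `solidB \ solidA` but differs between the two sectors
(`exists_stepInvariant_ne`). A failed labelling would connect two sectors
(`BoxLabellingFails.exists_eq`). -/

/-! ### The triangular lattice and the honeycomb graph -/

/-- The projections of the three unit vectors. -/
def latticeVec (i : Fin 3) : LatticePoint := proj (unitVec i)

theorem latticeVec_zero : latticeVec 0 = (1, 0) := by simp [latticeVec, proj, unitVec]
theorem latticeVec_one : latticeVec 1 = (0, 1) := by simp [latticeVec, proj, unitVec]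
theorem latticeVec_two : latticeVec 2 = (-1, -1) := by simp [latticeVec, proj, unitVec]

theorem proj_add (w v : Box) : proj (w + v) = proj w + proj v := by
  ext <;> simp [proj] <;> ring

theorem proj_add_unitVec (w : Box) (i : Fin 3) : proj (w + unitVec i) = proj w + latticeVec i :=
  proj_add _ _

/-- The box at height `t` above the lattice point `q`. -/
def liftBox (q : LatticePoint) (t : ℤ) : Box := ![q.1 + t, q.2 + t, t]

theorem proj_liftBox (q : LatticePoint) (t : ℤ) : proj (liftBox q t) = q := by
  ext <;> simp [proj, liftBox]

theorem liftBox_proj (w : Box) : liftBox (proj w) (w 2) = w := by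
  ext j
  fin_cases j <;> simp [proj, liftBox]

theorem liftBox_add_unitVec (q : LatticePoint) (t : ℤ) (i : Fin 3) :
    liftBox q t + unitVec i = liftBox (q + latticeVec i) (t + unitVec i 2) := by
  ext j
  fin_cases i <;> fin_cases j <;>
    simp [liftBox, unitVec, latticeVec_zero, latticeVec_one, latticeVec_two] <;> ring

theorem liftBox_le {q : LatticePoint} {s t : ℤ} (h : s ≤ t) : liftBox q s ≤ liftBox q t := by
  intro j
  fin_cases j <;> simpa [liftBox] using h

theorem liftBox_add_unitVec_sub_one_le (q : LatticePoint) (t : ℤ) (i : Fin 3) :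
    liftBox (q + latticeVec i) (t + unitVec i 2 - 1) ≤ liftBox q t := by
  intro j
  fin_cases i <;> fin_cases j <;>
    simp [liftBox, unitVec, latticeVec_zero, latticeVec_one, latticeVec_two]

theorem latticeVec_cycle (i : Fin 3) :
    latticeVec i + latticeVec (i + 1) + latticeVec (i + 2) = 0 := by
  fin_cases i <;> simp [latticeVec_zero, latticeVec_one, latticeVec_two]

/-- The upward triangle with the side from `q` to `q + latticeVec i`. -/
def upAt (q : LatticePoint) (i : Fin 3) : HexVertex :=
  .up (q - (![0, (1, 0), (1, 1)] : Fin 3 → LatticePoint) i)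

/-- The downward triangle with the side from `q` to `q + latticeVec i`. -/
def downAt (q : LatticePoint) (i : Fin 3) : HexVertex :=
  .down (q - (![(0, 1), 0, (1, 1)] : Fin 3 → LatticePoint) i)

theorem upAt_succ (q : LatticePoint) (i : Fin 3) :
    upAt (q + latticeVec i) (i + 1) = upAt q i := by
  obtain ⟨a, b⟩ := q
  fin_cases i <;> simp [upAt, latticeVec_zero, latticeVec_one, latticeVec_two, sub_eq_add_neg]

theorem downAt_pred (q : LatticePoint) (i : Fin 3) :
    downAt (q + latticeVec i) (i + 2) = downAt q i := by
  obtain ⟨a, b⟩ := q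
  fin_cases i <;> simp [downAt, latticeVec_zero, latticeVec_one, latticeVec_two, sub_eq_add_neg]

theorem upAt_injective (i : Fin 3) : Function.Injective fun q => upAt q i := by
  intro p q h
  simpa [upAt] using h

theorem corners_upAt (q : LatticePoint) (i : Fin 3) :
    (upAt q i).corners = {q, q + latticeVec i, q + latticeVec i + latticeVec (i + 1)} := by
  obtain ⟨a, b⟩ := q
  ext ⟨x, y⟩
  fin_cases i <;>
    simp [upAt, HexVertex.corners, latticeVec_zero, latticeVec_one, latticeVec_two] <;> omega

theorem corners_downAt (q : LatticePoint) (i : Fin 3) :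
    (downAt q i).corners = {q, q + latticeVec i, q + latticeVec i + latticeVec (i + 2)} := by
  obtain ⟨a, b⟩ := q
  ext ⟨x, y⟩
  fin_cases i <;>
    simp [downAt, HexVertex.corners, latticeVec_zero, latticeVec_one, latticeVec_two] <;> omega

theorem up_eq_upAt {p q : LatticePoint} {i : Fin 3} (h : q ∈ (HexVertex.up p).corners)
    (h' : q + latticeVec i ∈ (HexVertex.up p).corners) : HexVertex.up p = upAt q i := by
  obtain ⟨a, b⟩ := q
  obtain ⟨x, y⟩ := p
  fin_cases i <;>
    simp [upAt, HexVertex.corners, latticeVec_zero, latticeVec_one, latticeVec_two] at h h' ⊢ <;>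
    omega

theorem down_eq_downAt {p q : LatticePoint} {i : Fin 3} (h : q ∈ (HexVertex.down p).corners)
    (h' : q + latticeVec i ∈ (HexVertex.down p).corners) : HexVertex.down p = downAt q i := by
  obtain ⟨a, b⟩ := q
  obtain ⟨x, y⟩ := p
  fin_cases i <;>
    simp [downAt, HexVertex.corners, latticeVec_zero, latticeVec_one, latticeVec_two] at h h' ⊢ <;>
    omega

theorem exists_latticeVec_of_mem_corners {v : HexVertex} {p q : LatticePoint}
    (hp : p ∈ v.corners) (hq : q ∈ v.corners) :
    p = q ∨ ∃ i, q = p + latticeVec i ∨ p = q + latticeVec i := by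
  suffices h : p = q ∨ (q = p + latticeVec 0 ∨ p = q + latticeVec 0) ∨
      (q = p + latticeVec 1 ∨ p = q + latticeVec 1) ∨
      (q = p + latticeVec 2 ∨ p = q + latticeVec 2) by
    rcases h with h | h | h | h
    exacts [Or.inl h, Or.inr ⟨_, h⟩, Or.inr ⟨_, h⟩, Or.inr ⟨_, h⟩]
  obtain ⟨a, b⟩ := q
  obtain ⟨x, y⟩ := p
  obtain ⟨c, d⟩ | ⟨c, d⟩ := v <;>
    simp [HexVertex.corners, latticeVec_zero, latticeVec_one, latticeVec_two] at hp hq ⊢ <;> omega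

theorem finite_setOf_mem_corners (p : LatticePoint) : {v : HexVertex | p ∈ v.corners}.Finite := by
  refine ((Set.finite_range fun i => upAt p i).union
    (Set.finite_range fun i => downAt p i)).subset ?_
  obtain ⟨x, y⟩ := p
  rintro (⟨a, b⟩ | ⟨a, b⟩) h
  · refine Or.inl ?_
    simp [upAt, Fin.exists_fin_succ, HexVertex.corners] at h ⊢
    omega
  · refine Or.inr ?_
    simp [downAt, Fin.exists_fin_succ, HexVertex.corners] at h ⊢
    omega

/-! ### Surfaces and height functions -/

/-- The surface of `J` has a square between a box above `q` and its neighbour in direction `i`. -/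
def HasSquare (J : Set Box) (q : LatticePoint) (i : Fin 3) : Prop :=
  ∃ w ∈ J, proj w = q ∧ w + unitVec i ∉ J

theorem surfaceDimers_adj_iff {J : Set Box} {s t : HexVertex} :
    (surfaceDimers J).Adj s t ↔ ∃ q i, HasSquare J q i ∧
      (s = upAt q i ∧ t = downAt q i ∨ s = downAt q i ∧ t = upAt q i) := by
  constructor
  · rintro ⟨hne, w, i, hw, hw', ⟨h1, h2⟩, h3, h4⟩
    refine ⟨proj w, i, ⟨w, hw, rfl, hw'⟩, ?_⟩
    rw [proj_add_unitVec] at h3 h4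
    cases s <;> cases t
    · exact absurd ((up_eq_upAt h1 h3).trans (up_eq_upAt h2 h4).symm) hne
    · exact Or.inl ⟨up_eq_upAt h1 h3, down_eq_downAt h2 h4⟩
    · exact Or.inr ⟨down_eq_downAt h1 h3, up_eq_upAt h2 h4⟩
    · exact absurd ((down_eq_downAt h1 h3).trans (down_eq_downAt h2 h4).symm) hne
  · rintro ⟨q, i, ⟨w, hw, rfl, hw'⟩, h⟩
    have key : (surfaceDimers J).Adj (upAt (proj w) i) (downAt (proj w) i) := by
      refine ⟨by simp [upAt, downAt], w, i, hw, hw', ?_, ?_⟩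
      · simp [corners_upAt, corners_downAt]
      · simp [corners_upAt, corners_downAt, proj_add_unitVec]
    rcases h with ⟨rfl, rfl⟩ | ⟨rfl, rfl⟩
    · exact key
    · exact key.symm

/-- `H` is the height function of the surface of the solid `J`. -/
structure IsHeight (J : Set Box) (H : LatticePoint → ℤ) : Prop where
  mem_iff : ∀ q t, liftBox q t ∈ J ↔ t ≤ H q
  le_add : ∀ q i, H (q + latticeVec i) ≤ H q + unitVec i 2

theorem exists_isHeight {J : Set Box} (hJ : IsLowerSet J) (h1 : ∀ q, ∃ t, liftBox q t ∈ J)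
    (h2 : ∀ q, ∃ t, liftBox q t ∉ J) : ∃ H, IsHeight J H := by
  have key : ∀ q, ∃ a, ∀ t, liftBox q t ∈ J ↔ t ≤ a := by
    intro q
    obtain ⟨b, hb⟩ := h2 q
    obtain ⟨a, ha, hmax⟩ := Int.exists_greatest_of_bdd (P := fun t => liftBox q t ∈ J)
      ⟨b, fun t ht => not_lt.1 fun h => hb (hJ (liftBox_le h.le) ht)⟩ (h1 q)
    exact ⟨a, fun t => ⟨hmax t, fun h => hJ (liftBox_le h) ha⟩⟩
  choose H hH using key
  refine ⟨H, hH, fun q i => ?_⟩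
  have h := (hH (q + latticeVec i) (H (q + latticeVec i) - unitVec i 2 + unitVec i 2)).2 (by simp)
  rw [← liftBox_add_unitVec] at h
  have h' := (hH q _).1 (hJ (le_add_of_nonneg_right (by
    intro j; by_cases hj : j = i <;> simp [unitVec, hj])) h)
  omega

theorem unitVec_two_cycle (i : Fin 3) :
    unitVec i 2 + unitVec (i + 1) 2 + unitVec (i + 2) 2 = 1 := by
  fin_cases i <;> simp [unitVec]

section Height

variable {J : Set Box} {H : LatticePoint → ℤ}

/-- The other two lattice steps lead from `q + latticeVec i` back to `q` and together raise `H` by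
at most `1 - unitVec i 2`. -/
theorem IsHeight.sub_one_le (hH : IsHeight J H) (q : LatticePoint) (i : Fin 3) :
    H q + unitVec i 2 - 1 ≤ H (q + latticeVec i) := by
  have h1 := hH.le_add (q + latticeVec i) (i + 1)
  have h2 := hH.le_add (q + latticeVec i + latticeVec (i + 1)) (i + 2)
  rw [add_assoc q, add_assoc q, latticeVec_cycle, add_zero, ← add_assoc q] at h2
  have := unitVec_two_cycle i
  omega

theorem IsHeight.hasSquare_iff (hH : IsHeight J H) {q : LatticePoint} {i : Fin 3} :
    HasSquare J q i ↔ H (q + latticeVec i) = H q + unitVec i 2 - 1 := by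
  have h1 := hH.le_add q i
  have h2 := hH.sub_one_le q i
  constructor
  · rintro ⟨w, hw, rfl, hw'⟩
    rw [← liftBox_proj w, hH.mem_iff] at hw
    rw [← liftBox_proj w, liftBox_add_unitVec, hH.mem_iff] at hw'
    omega
  · intro h
    refine ⟨liftBox q (H q), (hH.mem_iff _ _).2 le_rfl, proj_liftBox _ _, ?_⟩
    rw [liftBox_add_unitVec, hH.mem_iff]
    omega

theorem IsHeight.of_not_hasSquare (hH : IsHeight J H) {q : LatticePoint} {i : Fin 3}
    (h : ¬ HasSquare J q i) : H (q + latticeVec i) = H q + unitVec i 2 := by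
  have h1 := hH.le_add q i
  have h2 := hH.sub_one_le q i
  rw [hH.hasSquare_iff] at h
  omega

theorem surfaceDimers_adj_up_down_iff {p p' : LatticePoint} :
    (surfaceDimers J).Adj (.up p) (.down p') ↔
      HasSquare J p 0 ∧ p' = p - (0, 1) ∨ HasSquare J (p + (1, 0)) 1 ∧ p' = p + (1, 0) ∨
        HasSquare J (p + (1, 1)) 2 ∧ p' = p := by
  rw [surfaceDimers_adj_iff]
  constructor
  · rintro ⟨q, i, hq, h⟩
    fin_cases i <;> simp [upAt, downAt] at h hq ⊢ <;> obtain ⟨rfl, rfl⟩ := h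
    · exact Or.inl ⟨by simpa using hq, by ext <;> simp⟩
    · exact Or.inr (Or.inl ⟨by simpa using hq, by ext <;> simp⟩)
    · exact Or.inr (Or.inr ⟨by simpa using hq, by ext <;> simp⟩)
  · rintro (⟨h, rfl⟩ | ⟨h, rfl⟩ | ⟨h, rfl⟩)
    · exact ⟨_, 0, h, Or.inl ⟨by simp [upAt], by simp [downAt]⟩⟩
    · exact ⟨_, 1, h, Or.inl ⟨by simp [upAt], by simp [downAt]⟩⟩
    · exact ⟨_, 2, h, Or.inl ⟨by simp [upAt], by simp [downAt]⟩⟩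

/-- The surface of a solid is a perfect matching of the honeycomb graph. -/
theorem IsHeight.exists_matching (hH : IsHeight J H) :
    ∃ e : LatticePoint ≃ LatticePoint, ∀ p p',
      (surfaceDimers J).Adj (.up p) (.down p') ↔ p' = e p := by
  -- Round a triangle the increments of `H` add up to 0, their upper bounds `unitVec i 2` add up to
  -- 1, and each increment is its bound or one less. So exactly one side carries a square.
  have hU : ∀ p, ∃ p', ∀ r, (surfaceDimers J).Adj (.up p) (.down r) ↔ r = p' := by
    rintro ⟨a, b⟩
    have h0 := hH.hasSquare_iff (q := (a, b)) (i := 0)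
    have h1 := hH.hasSquare_iff (q := (a + 1, b)) (i := 1)
    have h2 := hH.hasSquare_iff (q := (a + 1, b + 1)) (i := 2)
    have k0 := hH.of_not_hasSquare (q := (a, b)) (i := 0)
    have k1 := hH.of_not_hasSquare (q := (a + 1, b)) (i := 1)
    have k2 := hH.of_not_hasSquare (q := (a + 1, b + 1)) (i := 2)
    simp only [surfaceDimers_adj_up_down_iff]
    simp [unitVec, latticeVec_zero, latticeVec_one, latticeVec_two] at h0 h1 h2 k0 k1 k2 ⊢
    by_cases s0 : HasSquare J (a, b) 0
    · have s1 : ¬ HasSquare J (a + 1, b) 1 := by grind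
      have s2 : ¬ HasSquare J (a + 1, b + 1) 2 := by grind
      exact ⟨a, b - 1, by simp [s0, s1, s2]⟩
    by_cases s1 : HasSquare J (a + 1, b) 1
    · have s2 : ¬ HasSquare J (a + 1, b + 1) 2 := by grind
      exact ⟨a + 1, b, by simp [s0, s1, s2]⟩
    · have s2 : HasSquare J (a + 1, b + 1) 2 := by grind
      exact ⟨a, b, by simp [s0, s1, s2]⟩
  have hD : ∀ p, ∃ p', ∀ r, (surfaceDimers J).Adj (.up r) (.down p) ↔ r = p' := by
    rintro ⟨a, b⟩
    have h0 := hH.hasSquare_iff (q := (a, b + 1)) (i := 0)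
    have h1 := hH.hasSquare_iff (q := (a, b)) (i := 1)
    have h2 := hH.hasSquare_iff (q := (a + 1, b + 1)) (i := 2)
    have k0 := hH.of_not_hasSquare (q := (a, b + 1)) (i := 0)
    have k1 := hH.of_not_hasSquare (q := (a, b)) (i := 1)
    have k2 := hH.of_not_hasSquare (q := (a + 1, b + 1)) (i := 2)
    have e : ∀ r, (surfaceDimers J).Adj (.up r) (.down (a, b)) ↔
        HasSquare J (a, b + 1) 0 ∧ r = (a, b + 1) ∨ HasSquare J (a, b) 1 ∧ r = (a - 1, b) ∨
        HasSquare J (a + 1, b + 1) 2 ∧ r = (a, b) := by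
      rintro ⟨x, y⟩
      rw [surfaceDimers_adj_up_down_iff]
      simp
      grind
    simp only [e]
    simp [unitVec, latticeVec_zero, latticeVec_one, latticeVec_two] at h0 h1 h2 k0 k1 k2 ⊢
    by_cases s0 : HasSquare J (a, b + 1) 0
    · have s1 : ¬ HasSquare J (a, b) 1 := by grind
      have s2 : ¬ HasSquare J (a + 1, b + 1) 2 := by grind
      exact ⟨a, b + 1, by simp [s0, s1, s2]⟩
    by_cases s1 : HasSquare J (a, b) 1
    · have s2 : ¬ HasSquare J (a + 1, b + 1) 2 := by grind
      exact ⟨a - 1, b, by simp [s0, s1, s2]⟩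
    · have s2 : HasSquare J (a + 1, b + 1) 2 := by grind
      exact ⟨a, b, by simp [s0, s1, s2]⟩
  choose f hf using hU
  choose g hg using hD
  exact ⟨⟨f, g, fun p => ((hg _ _).1 ((hf _ _).2 rfl)).symm,
    fun p => ((hf _ _).1 ((hg _ _).2 rfl)).symm⟩, hf⟩

theorem surfaceDimers_not_adj_up_up {p p' : LatticePoint} :
    ¬ (surfaceDimers J).Adj (.up p) (.up p') := by
  rw [surfaceDimers_adj_iff]
  rintro ⟨q, i, -, ⟨-, h⟩ | ⟨h, -⟩⟩ <;> cases h

theorem surfaceDimers_not_adj_down_down {p p' : LatticePoint} :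
    ¬ (surfaceDimers J).Adj (.down p) (.down p') := by
  rw [surfaceDimers_adj_iff]
  rintro ⟨q, i, -, ⟨h, -⟩ | ⟨-, h⟩⟩ <;> cases h

theorem IsHeight.adj_unique (hH : IsHeight J H) {s t t' : HexVertex}
    (h : (surfaceDimers J).Adj s t) (h' : (surfaceDimers J).Adj s t') : t = t' := by
  obtain ⟨e, he⟩ := hH.exists_matching
  cases s with
  | up p =>
    cases t with
    | up => exact absurd h surfaceDimers_not_adj_up_up
    | down q => cases t' with
      | up => exact absurd h' surfaceDimers_not_adj_up_up
      | down q' => rw [(he _ _).1 h, (he _ _).1 h']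
  | down p =>
    cases t with
    | down => exact absurd h surfaceDimers_not_adj_down_down
    | up q => cases t' with
      | down => exact absurd h' surfaceDimers_not_adj_down_down
      | up q' => rw [e.injective (((he _ _).1 h.symm).symm.trans ((he _ _).1 h'.symm))]

end Height

/-! ### Potentials on the plane -/

theorem exists_primitive (g : ℤ → ℤ) : ∃ F : ℤ → ℤ, ∀ n, F (n + 1) - F n = g n := by
  -- One of the two sums is always empty, which covers both signs of `n`.
  refine ⟨fun n => ∑ i ∈ Finset.Ico 0 n, g i - ∑ i ∈ Finset.Ico n 0, g i, fun n => ?_⟩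
  rcases le_or_gt 0 n with h | h
  · have e : Finset.Ico 0 (n + 1) = insert n (Finset.Ico 0 n) := by
      ext; simp; omega
    simp only [e]
    rw [Finset.sum_insert (by simp), Finset.Ico_eq_empty (a := n) (by omega),
      Finset.Ico_eq_empty (a := n + 1) (by omega)]
    simp
  · have e : Finset.Ico n 0 = insert n (Finset.Ico (n + 1) 0) := by
      ext; simp; omega
    simp only [e]
    rw [Finset.sum_insert (by simp), Finset.Ico_eq_empty (b := n) (by omega),
      Finset.Ico_eq_empty (b := n + 1) (by omega)]
    simp

theorem exists_potential {c d : ℤ → ℤ → ℤ}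
    (h : ∀ a b, c a b + d (a + 1) b = d a b + c a (b + 1)) :
    ∃ χ : ℤ → ℤ → ℤ, ∀ a b, χ (a + 1) b - χ a b = c a b ∧ χ a (b + 1) - χ a b = d a b := by
  obtain ⟨F, hF⟩ := exists_primitive fun a => c a 0
  choose G hG using fun a => exists_primitive (d a)
  -- Integration along the row `b = 0`, then along the column; closedness on unit squares moves the
  -- horizontal increment from row 0 to row `b`.
  refine ⟨fun a b => F a + (G a b - G a 0), fun a b => ⟨?_, by linarith [hG a b]⟩⟩
  have key : G (a + 1) b - G (a + 1) 0 - (G a b - G a 0) = c a b - c a 0 := by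
    induction b using Int.induction_on with
    | zero => simp
    | succ n ih => linarith [hG a n, hG (a + 1) n, h a n]
    | pred n ih =>
      have h1 := hG a (-n - 1)
      have h2 := hG (a + 1) (-n - 1)
      have h3 := h a (-n - 1)
      simp only [sub_add_cancel] at h1 h2 h3
      linarith
  linarith [hF a]

/-- A closed `1`-cochain on the triangular lattice is exact. -/
theorem exists_lattice_potential {c : LatticePoint → Fin 3 → ℤ}
    (hup : ∀ q i, c q i + c (q + latticeVec i) (i + 1) +
      c (q + latticeVec i + latticeVec (i + 1)) (i + 2) = 0)
    (hdown : ∀ q i, c q i + c (q + latticeVec i) (i + 2) +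
      c (q + latticeVec i + latticeVec (i + 2)) (i + 1) = 0) :
    ∃ χ : LatticePoint → ℤ, ∀ q i, χ (q + latticeVec i) - χ q = c q i := by
  obtain ⟨χ, hχ⟩ := exists_potential (c := fun a b => c (a, b) 0) (d := fun a b => c (a, b) 1) <| by
    intro a b
    have h1 := hup (a, b) 0
    have h2 := hdown (a, b) 1
    simp [latticeVec_zero, latticeVec_one] at h1 h2
    linarith
  refine ⟨fun q => χ q.1 q.2, fun q i => ?_⟩
  obtain ⟨a, b⟩ := q
  have h0 := hχ a b
  fin_cases i
  · simpa [latticeVec_zero] using h0.1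
  · simpa [latticeVec_one] using h0.2
  · have h1 := (hχ (a - 1) (b - 1)).1
    have h2 := (hχ a (b - 1)).2
    have h3 := hup (a, b) 2
    have e : (2 : Fin 3) + 1 = 0 := rfl
    have e' : (2 : Fin 3) + 2 = 1 := rfl
    simp [latticeVec_two, e, e', latticeVec_zero] at h1 h2 h3 ⊢
    simp only [← sub_eq_add_neg] at h3 ⊢
    linarith

/-! ### Order-convex sets of boxes -/

theorem unitVec_nonneg (i : Fin 3) : 0 ≤ unitVec i := by
  intro j; by_cases hj : j = i <;> simp [unitVec, hj]

theorem box_induction_le {P : Box → Prop} {v w : Box} (hvw : v ≤ w) (hv : P v)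
    (step : ∀ u i, v ≤ u → u + unitVec i ≤ w → P u → P (u + unitVec i)) : P w := by
  obtain ⟨n, hn⟩ : ∃ n : ℕ, ∑ i, (w i - v i) = n :=
    Int.eq_ofNat_of_zero_le (Finset.sum_nonneg fun i _ => sub_nonneg.2 (hvw i))
  induction n generalizing w with
  | zero =>
    have h := (Finset.sum_eq_zero_iff_of_nonneg fun i _ => sub_nonneg.2 (hvw i)).1 hn
    have : v = w := funext fun i => by linarith [h i (Finset.mem_univ i)]
    rwa [← this]
  | succ n ih =>
    obtain ⟨i, hi⟩ : ∃ i, v i < w i := by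
      by_contra! h
      have : ∑ i, (w i - v i) ≤ 0 := Finset.sum_nonpos fun i _ => by linarith [h i]
      omega
    have h1 : v ≤ w - unitVec i := by
      intro j
      by_cases hj : j = i
      · subst hj; simp [unitVec]; omega
      · simpa [unitVec, hj] using hvw j
    have h2 : ∑ j, ((w - unitVec i) j - v j) = n := by
      have : ∑ j, ((w - unitVec i) j - v j) = ∑ j, (w j - v j) - ∑ j, unitVec i j := by
        rw [← Finset.sum_sub_distrib]
        exact Finset.sum_congr rfl fun j _ => by simp; ring
      rw [this, hn]
      simp [unitVec]
    have h3 := ih h1 (fun u j hu huw => step u j hu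
      (huw.trans (sub_le_self _ (unitVec_nonneg i)))) h2
    simpa using step (w - unitVec i) i h1 (by simp) h3

theorem isLowerSet_of_step {J : Set Box} (h : ∀ w i, w + unitVec i ∈ J → w ∈ J) :
    IsLowerSet J := by
  intro w v hvw hw
  by_contra hv
  exact box_induction_le (P := fun u => u ∉ J) hvw hv (fun u i _ _ hu hu' => hu (h u i hu')) hw

/-- `f` does not change along steps inside the set `J' \ J`. -/
def StepInvariant {α : Type*} (J J' : Set Box) (f : Box → α) : Prop :=
  ∀ w i, w ∈ J' \ J → w + unitVec i ∈ J' \ J → f (w + unitVec i) = f w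

/-- A difference of lower sets is order-convex, so a monotone lattice path from `v` to `w` never
leaves it. -/
theorem StepInvariant.eq_of_le {α : Type*} {J J' : Set Box} {f : Box → α}
    (hf : StepInvariant J J' f) (hJ : IsLowerSet J) (hJ' : IsLowerSet J') {v w : Box}
    (hvw : v ≤ w) (hv : v ∈ J' \ J) (hw : w ∈ J' \ J) : f w = f v := by
  refine box_induction_le (P := fun u => f u = f v) hvw rfl fun u i hu huw h => ?_
  have hle : u ≤ u + unitVec i := le_add_of_nonneg_right (unitVec_nonneg i)
  rw [hf u i ⟨hJ' (hle.trans huw) hw.1, fun h => hv.2 (hJ hu h)⟩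
    ⟨hJ' huw hw.1, fun h => hv.2 (hJ (hu.trans hle) h)⟩, h]

/-! ### Cylinders and solids -/

theorem mem_Cyl {μ : Fin 3 → YoungDiagram} {i : Fin 3} {w : Box} :
    w ∈ Cyl μ i ↔ 0 ≤ w (i + 1) ∧ 0 ≤ w (i + 2) ∧
      ((w (i + 1)).toNat, (w (i + 2)).toNat) ∈ μ i := by
  constructor
  · rintro ⟨u, v, h, h1, h2⟩
    simp [h1, h2, h]
  · rintro ⟨h1, h2, h⟩
    exact ⟨_, _, h, by simp [h1], by simp [h2]⟩

theorem mem_Cyl_of_le {μ : Fin 3 → YoungDiagram} {i : Fin 3} {w w' : Box} (hw : w ∈ Cyl μ i)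
    (h1 : 0 ≤ w' (i + 1)) (h1' : w' (i + 1) ≤ w (i + 1)) (h2 : 0 ≤ w' (i + 2))
    (h2' : w' (i + 2) ≤ w (i + 2)) : w' ∈ Cyl μ i := by
  rw [mem_Cyl] at hw ⊢
  exact ⟨h1, h2, (μ i).up_left_mem (Int.toNat_le_toNat h1') (Int.toNat_le_toNat h2') hw.2.2⟩

theorem Fin.eq_or_eq_add (i j : Fin 3) : j = i ∨ j = i + 1 ∨ j = i + 2 := by
  revert i j; decide

theorem nonneg_of_mem_Cyl {μ : Fin 3 → YoungDiagram} {i j : Fin 3} {w : Box} (hw : w ∈ Cyl μ i)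
    (hj : j ≠ i) : 0 ≤ w j := by
  rw [mem_Cyl] at hw
  rcases Fin.eq_or_eq_add i j with rfl | rfl | rfl
  · exact absurd rfl hj
  · exact hw.1
  · exact hw.2.1

theorem mem_Cyl_mono {μ : Fin 3 → YoungDiagram} {i : Fin 3} {w w' : Box} (hw : w ∈ Cyl μ i)
    (h0 : ∀ j, j ≠ i → 0 ≤ w' j) (h : ∀ j, j ≠ i → w' j ≤ w j) : w' ∈ Cyl μ i :=
  mem_Cyl_of_le hw (h0 _ (by simp)) (h _ (by simp)) (h0 _ (by simp)) (h _ (by simp))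

theorem exists_cyl_bound (μ : Fin 3 → YoungDiagram) :
    ∃ N : ℤ, 0 ≤ N ∧ ∀ i, ∀ w ∈ Cyl μ i, ∀ j, j ≠ i → w j < N := by
  obtain ⟨N, hN⟩ : ∃ N : ℕ, ∀ i, ∀ c ∈ (μ i).cells, c.1 + c.2 < N := by
    refine ⟨(∑ i, ∑ c ∈ (μ i).cells, (c.1 + c.2)) + 1, fun i c hc => Nat.lt_succ_of_le ?_⟩
    exact (Finset.single_le_sum (f := fun c : ℕ × ℕ => c.1 + c.2) (fun _ _ => Nat.zero_le _)
      hc).trans (Finset.single_le_sum (f := fun i => ∑ c ∈ (μ i).cells, (c.1 + c.2))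
        (fun _ _ => Nat.zero_le _) (Finset.mem_univ i))
  refine ⟨N, by simp, fun i w hw j hj => ?_⟩
  obtain ⟨u, v, h, h1, h2⟩ := hw
  have := hN i (u, v) h
  rcases Fin.eq_or_eq_add i j with rfl | rfl | rfl
  · exact absurd rfl hj
  · rw [h1]; simp at this; omega
  · rw [h2]; simp at this; omega

theorem mem_octant_of_mem_RegionIIBar {μ : Fin 3 → YoungDiagram} {i : Fin 3} {w : Box}
    (hw : w ∈ RegionIIBar μ i) : w ∈ octant := by
  intro j
  by_cases hj : j = i + 1
  · exact nonneg_of_mem_Cyl hw.1.2 (by rw [hj]; simp)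
  · exact nonneg_of_mem_Cyl hw.1.1 hj

theorem mem_RegionII_union_RegionIII {μ : Fin 3 → YoungDiagram} {w : Box} :
    w ∈ RegionII μ ∪ RegionIII μ ↔ ∃ i j, i ≠ j ∧ w ∈ Cyl μ i ∧ w ∈ Cyl μ j := by
  constructor
  · rintro (h | h)
    · obtain ⟨i, h⟩ := Set.mem_iUnion.1 h
      exact ⟨_, _, by simp, h.1.1, h.1.2⟩
    · exact ⟨0, 1, by simp, Set.mem_iInter.1 h 0, Set.mem_iInter.1 h 1⟩
  · rintro ⟨i, j, hij, hi, hj⟩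
    obtain ⟨k, hk⟩ : ∃ k : Fin 3, (i = k + 1 ∧ j = k + 2) ∨ (i = k + 2 ∧ j = k + 1) := by
      exact (by decide : ∀ i j : Fin 3, i ≠ j →
        ∃ k : Fin 3, (i = k + 1 ∧ j = k + 2) ∨ (i = k + 2 ∧ j = k + 1)) i j hij
    by_cases h : w ∈ Cyl μ k
    · refine Or.inr (Set.mem_iInter.2 fun l => ?_)
      rcases hk with ⟨rfl, rfl⟩ | ⟨rfl, rfl⟩ <;> rcases Fin.eq_or_eq_add k l with rfl | rfl | rfl <;>
        assumption
    · refine Or.inl (Set.mem_iUnion.2 ⟨k, ?_⟩)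
      rcases hk with ⟨rfl, rfl⟩ | ⟨rfl, rfl⟩
      · exact ⟨⟨hi, hj⟩, h⟩
      · exact ⟨⟨hj, hi⟩, h⟩

theorem mem_octant_of_mem_RegionIII {μ : Fin 3 → YoungDiagram} {w : Box}
    (hw : w ∈ RegionIII μ) : w ∈ octant := by
  intro j
  exact nonneg_of_mem_Cyl (Set.mem_iInter.1 hw (j + 1)) (by simp)

theorem neg_of_mem_CylNeg {μ : Fin 3 → YoungDiagram} {i : Fin 3} {w : Box}
    (hw : w ∈ CylNeg μ i) : w i < 0 := by
  by_contra! h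
  refine hw.2 fun j => ?_
  by_cases hj : j = i
  · rwa [hj]
  · exact nonneg_of_mem_Cyl hw.1 hj

theorem finite_RegionII_union_RegionIII (μ : Fin 3 → YoungDiagram) :
    (RegionII μ ∪ RegionIII μ).Finite := by
  obtain ⟨N, -, hN⟩ := exists_cyl_bound μ
  refine (Set.finite_Icc (0 : Box) fun _ => N).subset fun w hw => ?_
  obtain ⟨i, j, hij, hi, hj⟩ := mem_RegionII_union_RegionIII.1 hw
  refine ⟨fun l => ?_, fun l => ?_⟩ <;> by_cases hl : l = i
  · exact nonneg_of_mem_Cyl hj (by rwa [hl])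
  · exact nonneg_of_mem_Cyl hi hl
  · exact (hN j w hj l (by rwa [hl])).le
  · exact (hN i w hi l hl).le

theorem finite_labelledCells {μ : Fin 3 → YoungDiagram} {A B : Set Box}
    (h : IsABConfiguration μ A B) : (labelledCells μ A B).Finite := by
  refine (h.finite_A.union (finite_RegionII_union_RegionIII μ)).subset ?_
  rintro w ((hw | hw) | hw)
  · exact Or.inl hw.2
  · exact Or.inr (Or.inl hw.1)
  · exact Or.inr (Or.inr hw.1)

theorem le_add_unitVec (w : Box) (i j : Fin 3) : w j ≤ (w + unitVec i) j :=
  (le_add_of_nonneg_right (unitVec_nonneg i) : w ≤ w + unitVec i) j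

/-- A step back from `I⁻ ∪ III` either creates a second negative coordinate or stays in the region,
where the stacking condition keeps the box out of `A`. -/
theorem isLowerSet_solidA {μ : Fin 3 → YoungDiagram} {A B : Set Box}
    (h : IsABConfiguration μ A B) : IsLowerSet (solidA μ A) := by
  refine isLowerSet_of_step fun w i hw => ?_
  have hle := le_add_unitVec w i
  have hne : ∀ j, j ≠ i → (w + unitVec i) j = w j := fun j hj => by simp [unitVec, hj]
  rcases hw with ⟨a, b, hab, ha, hb⟩ | ⟨hw, hwA⟩
  · exact Or.inl ⟨a, b, hab, (hle a).trans_lt ha, (hle b).trans_lt hb⟩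
  by_cases h2 : ∃ a b, a ≠ b ∧ w a < 0 ∧ w b < 0
  · exact Or.inl h2
  push Not at h2
  suffices hR : w ∈ RegionINeg μ ∪ RegionIII μ from
    Or.inr ⟨hR, fun hA => hwA (h.stacked_A _ hw ⟨i, by simpa using hA⟩)⟩
  rcases hw with hw | hw
  · obtain ⟨l, hw⟩ := Set.mem_iUnion.1 hw
    have hl : w l < 0 := (hle l).trans_lt (neg_of_mem_CylNeg hw)
    refine Or.inl (Set.mem_iUnion.2 ⟨l, mem_Cyl_mono hw.1 (fun j hj => h2 l j hj.symm hl)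
      fun j _ => hle j, fun ho => ?_⟩)
    exact absurd (ho l) (not_le.2 hl)
  · by_cases hi : 0 ≤ w i
    · have ho : ∀ j, 0 ≤ w j := fun j => by
        by_cases hj : j = i
        · rwa [hj]
        · rw [← hne j hj]; exact mem_octant_of_mem_RegionIII hw j
      exact Or.inr (Set.mem_iInter.2 fun l =>
        mem_Cyl_mono (Set.mem_iInter.1 hw l) (fun j _ => ho j) fun j _ => hle j)
    · exact Or.inl (Set.mem_iUnion.2 ⟨i, mem_Cyl_mono (Set.mem_iInter.1 hw i)
        (fun j hj => h2 i j hj.symm (not_le.1 hi)) fun j _ => hle j, fun ho => hi (ho i)⟩)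

theorem isLowerSet_solidB {μ : Fin 3 → YoungDiagram} {A B : Set Box}
    (h : IsABConfiguration μ A B) : IsLowerSet (solidB μ B) := by
  refine isLowerSet_of_step fun w i hw => ?_
  have hle := le_add_unitVec w i
  by_cases ho : w ∈ octant
  swap
  · exact Or.inl ho
  rcases hw with hw | ⟨hw, hwB⟩
  · exact absurd (fun j => (ho j).trans (hle j)) hw
  refine Or.inr ⟨?_, fun hB => hwB (h.stacked_B _ hw ⟨i, by simpa using hB⟩)⟩
  rw [mem_RegionII_union_RegionIII] at hw ⊢
  obtain ⟨a, b, hab, ha, hb⟩ := hw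
  exact ⟨a, b, hab, mem_Cyl_mono ha (fun j _ => ho j) fun j _ => hle j,
    mem_Cyl_mono hb (fun j _ => ho j) fun j _ => hle j⟩

theorem not_mem_solidA_of_octant {μ : Fin 3 → YoungDiagram} {A : Set Box} {w : Box}
    (ho : w ∈ octant) (h : w ∉ RegionIII μ) : w ∉ solidA μ A := by
  rintro (⟨a, b, -, ha, -⟩ | ⟨hw | hw, -⟩)
  · exact absurd (ho a) (not_le.2 ha)
  · obtain ⟨l, hw⟩ := Set.mem_iUnion.1 hw
    exact hw.2 ho
  · exact h hw

theorem liftBox_coord_neg (q : LatticePoint) {t : ℤ} (h : t < -(|q.1| + |q.2|)) (j : Fin 3) :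
    liftBox q t j < 0 := by
  have := neg_abs_le q.1
  have := neg_abs_le q.2
  have := le_abs_self q.1
  have := le_abs_self q.2
  fin_cases j <;> simp [liftBox] <;> omega

theorem lt_liftBox_coord (q : LatticePoint) {t N : ℤ} (h : N + |q.1| + |q.2| < t) (j : Fin 3) :
    N < liftBox q t j := by
  have := neg_abs_le q.1
  have := neg_abs_le q.2
  have := le_abs_self q.1
  have := le_abs_self q.2
  fin_cases j <;> simp [liftBox] <;> omega

/-- Low boxes of a column have only negative coordinates; high ones have all coordinates beyond the
bound `N` and lie in no cylinder. -/
theorem exists_isHeight_solidA {μ : Fin 3 → YoungDiagram} {A B : Set Box}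
    (h : IsABConfiguration μ A B) : ∃ H, IsHeight (solidA μ A) H := by
  refine exists_isHeight (isLowerSet_solidA h) (fun q => ⟨-(|q.1| + |q.2|) - 1, Or.inl ⟨0, 1,
    by simp, liftBox_coord_neg q (by omega) 0, liftBox_coord_neg q (by omega) 1⟩⟩) fun q => ?_
  obtain ⟨N, hN0, hN⟩ := exists_cyl_bound μ
  have hlt := lt_liftBox_coord q (t := N + |q.1| + |q.2| + 1) (N := N) (by omega)
  refine ⟨_, not_mem_solidA_of_octant (fun j => hN0.trans (hlt j).le) fun hw => ?_⟩
  exact absurd (hN 0 _ (Set.mem_iInter.1 hw 0) 1 (by simp)) (not_lt.2 (hlt 1).le)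

theorem exists_isHeight_solidB {μ : Fin 3 → YoungDiagram} {A B : Set Box}
    (h : IsABConfiguration μ A B) : ∃ H, IsHeight (solidB μ B) H := by
  refine exists_isHeight (isLowerSet_solidB h) (fun q => ⟨-(|q.1| + |q.2|) - 1, Or.inl fun ho =>
    absurd (ho 0) (not_le.2 (liftBox_coord_neg q (by omega) 0))⟩) fun q => ?_
  obtain ⟨N, hN0, hN⟩ := exists_cyl_bound μ
  have hlt := lt_liftBox_coord q (t := N + |q.1| + |q.2| + 1) (N := N) (by omega)
  refine ⟨N + |q.1| + |q.2| + 1, ?_⟩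
  rintro (hw | ⟨hw, -⟩)
  · exact hw fun j => hN0.trans (hlt j).le
  · obtain ⟨a, b, hab, ha, -⟩ := mem_RegionII_union_RegionIII.1 hw
    exact absurd (hN a _ ha b hab.symm) (not_lt.2 (hlt b).le)

/-! ### The cells between the two surfaces -/

/-- The boxes whose only negative coordinate is the one in direction `i`, outside `Cyl μ i`. -/
def outerCells (μ : Fin 3 → YoungDiagram) (i : Fin 3) : Set Box :=
  {w | w i < 0 ∧ (∀ j, j ≠ i → 0 ≤ w j) ∧ w ∉ Cyl μ i}

theorem not_mem_octant_of_neg {w : Box} {i : Fin 3} (h : w i < 0) : w ∉ octant :=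
  fun ho => absurd (ho i) (not_le.2 h)

section Cells

variable {μ : Fin 3 → YoungDiagram} {A B : Set Box} {w w' : Box} {i j : Fin 3}

theorem not_mem_octant_of_mem_RegionINeg (hw : w ∈ RegionINeg μ) : w ∉ octant := by
  obtain ⟨l, hw⟩ := Set.mem_iUnion.1 hw
  exact hw.2

theorem mem_octant_of_mem_RegionII (hw : w ∈ RegionII μ) : w ∈ octant := by
  obtain ⟨l, hw⟩ := Set.mem_iUnion.1 hw
  exact mem_octant_of_mem_RegionIIBar hw

theorem not_mem_RegionIII_of_mem_RegionII (hw : w ∈ RegionII μ) : w ∉ RegionIII μ := by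
  obtain ⟨l, hw⟩ := Set.mem_iUnion.1 hw
  exact fun h => hw.2 (Set.mem_iInter.1 h l)

theorem mem_CylNeg_of_neg (hw : w ∈ labelledCells μ A B) (hi : w i < 0) : w ∈ CylNeg μ i := by
  have ho := not_mem_octant_of_neg hi
  rcases hw with (hw | hw) | hw
  · obtain ⟨l, hl⟩ := Set.mem_iUnion.1 hw.1
    have : i = l := by
      by_contra hne
      exact absurd (nonneg_of_mem_Cyl hl.1 hne) (not_le.2 hi)
    rwa [this]
  · exact absurd (mem_octant_of_mem_RegionII hw.1) ho
  · exact absurd (mem_octant_of_mem_RegionIII hw.1) ho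

theorem mem_RegionIIBar_of_octant (hw : w ∈ labelledCells μ A B) (ho : w ∈ octant)
    (hi : w ∉ Cyl μ i) : w ∈ RegionIIBar μ i := by
  rcases hw with (hw | hw) | hw
  · exact absurd ho (not_mem_octant_of_mem_RegionINeg hw.1)
  · obtain ⟨l, hl⟩ := Set.mem_iUnion.1 hw.1
    have : l = i := by
      rcases Fin.eq_or_eq_add l i with h | h | h
      · exact h.symm
      · exact absurd (h ▸ hl.1.1) hi
      · exact absurd (h ▸ hl.1.2) hi
    rwa [← this]
  · exact absurd (Set.mem_iInter.1 hw.1 i) hi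

theorem eq_of_mem_outerCells_of_neg (hw : w ∈ outerCells μ i) (hj : w j < 0) : j = i := by
  by_contra h
  exact absurd (hw.2.1 j h) (not_le.2 hj)

theorem outerCells_not_mem_labelledCells (hw : w ∈ outerCells μ i) : w ∉ labelledCells μ A B :=
  fun h => hw.2.2 (mem_CylNeg_of_neg h hw.1).1

theorem not_two_neg_of_nonneg (h : ∀ j, j ≠ i → 0 ≤ w j) :
    ¬ ∃ a b, a ≠ b ∧ w a < 0 ∧ w b < 0 := by
  rintro ⟨a, b, hab, ha, hb⟩
  by_cases hi : a = i
  · exact absurd (h b (by rw [← hi]; exact hab.symm)) (not_le.2 hb)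
  · exact absurd (h a hi) (not_le.2 ha)

theorem outerCells_subset : outerCells μ i ⊆ solidB μ B \ solidA μ A := by
  intro w hw
  refine ⟨Or.inl (not_mem_octant_of_neg hw.1), ?_⟩
  rintro (h | ⟨h | h, -⟩)
  · exact not_two_neg_of_nonneg hw.2.1 h
  · obtain ⟨l, hl⟩ := Set.mem_iUnion.1 h
    have := eq_of_mem_outerCells_of_neg hw (neg_of_mem_CylNeg hl)
    exact hw.2.2 (this ▸ hl.1)
  · exact hw.2.2 (Set.mem_iInter.1 h i)

/-- As there are only finitely many labelled cells, this yields `H ≤ H'` over all but finitely many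
lattice points. -/
theorem mem_labelledCells_of_mem_solidA (hA : w ∈ solidA μ A) (hB : w ∉ solidB μ B) :
    w ∈ labelledCells μ A B := by
  have ho : w ∈ octant := by
    by_contra h
    exact hB (Or.inl h)
  rcases hA with ⟨a, b, -, ha, -⟩ | ⟨h | h, hA⟩
  · exact absurd (ho a) (not_le.2 ha)
  · exact absurd ho (not_mem_octant_of_mem_RegionINeg h)
  · refine Or.inr ⟨h, Or.inr ⟨?_, hA⟩⟩
    by_contra hnB
    exact hB (Or.inr ⟨Or.inr h, hnB⟩)

theorem mem_outerCells_or_mem_labelledCells (hw : w ∈ solidB μ B \ solidA μ A) :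
    (∃ i, w ∈ outerCells μ i) ∨ w ∈ labelledCells μ A B := by
  obtain ⟨hB, hA⟩ := hw
  rcases hB with ho | ⟨h | h, hnB⟩
  · obtain ⟨i, hi⟩ : ∃ i, w i < 0 := by
      by_contra! h
      exact ho h
    have hpos : ∀ j, j ≠ i → 0 ≤ w j := by
      intro j hj
      by_contra! h
      exact hA (Or.inl ⟨i, j, hj.symm, hi, h⟩)
    by_cases hC : w ∈ Cyl μ i
    · have hI : w ∈ RegionINeg μ := Set.mem_iUnion.2 ⟨i, hC, ho⟩
      refine Or.inr (Or.inl (Or.inl ⟨hI, ?_⟩))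
      by_contra hnA
      exact hA (Or.inr ⟨Or.inl hI, hnA⟩)
    · exact Or.inl ⟨i, hi, hpos, hC⟩
  · exact Or.inr (Or.inl (Or.inr ⟨h, hnB⟩))
  · refine Or.inr (Or.inr ⟨h, Or.inl ⟨?_, hnB⟩⟩)
    by_contra hnA
    exact hA (Or.inr ⟨Or.inr h, hnA⟩)

theorem labelledCells_subset (hw : w ∈ labelledCells μ A B) :
    w ∈ solidB μ B \ solidA μ A ∨ w ∈ solidA μ A \ solidB μ B := by
  rcases hw with (⟨hI, hA⟩ | ⟨hI, hB⟩) | ⟨hI, ⟨hA, hB⟩ | ⟨hB, hA⟩⟩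
  · have ho := not_mem_octant_of_mem_RegionINeg hI
    refine Or.inl ⟨Or.inl ho, ?_⟩
    rintro (h | h)
    · obtain ⟨l, hl⟩ := Set.mem_iUnion.1 hI
      exact not_two_neg_of_nonneg (fun j hj => nonneg_of_mem_Cyl hl.1 hj) h
    · exact h.2 hA
  · exact Or.inl ⟨Or.inr ⟨Or.inl hI, hB⟩, not_mem_solidA_of_octant (mem_octant_of_mem_RegionII hI)
      (not_mem_RegionIII_of_mem_RegionII hI)⟩
  · refine Or.inl ⟨Or.inr ⟨Or.inr hI, hB⟩, ?_⟩
    have ho := mem_octant_of_mem_RegionIII hI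
    rintro (⟨a, b, -, ha, -⟩ | h)
    · exact absurd (ho a) (not_le.2 ha)
    · exact h.2 hA
  · refine Or.inr ⟨Or.inr ⟨Or.inr hI, hA⟩, ?_⟩
    rintro (h | h)
    · exact h (mem_octant_of_mem_RegionIII hI)
    · exact h.2 hB

/-- A labelled cell next to an outer cell in sector `i` is given the label `i`. -/
theorem mem_of_adj_outerCells (hw : w ∈ outerCells μ i) (hw' : w' ∈ labelledCells μ A B)
    (h : boxGraph.Adj w w') : w' ∈ CylNeg μ i ∪ RegionIIBar μ i := by
  by_cases hi : w' i < 0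
  · exact Or.inl (mem_CylNeg_of_neg hw' hi)
  obtain ⟨l, rfl | rfl⟩ := h
  · have hl : l = i := by
      by_contra hl
      refine hi ?_
      have : (w + unitVec l) i = w i := by simp [unitVec, Ne.symm hl]
      rw [this]; exact hw.1
    subst hl
    have hne : ∀ j, j ≠ l → (w + unitVec l) j = w j := fun j hj => by simp [unitVec, hj]
    refine Or.inr (mem_RegionIIBar_of_octant hw' (fun j => ?_) fun hC => hw.2.2 ?_)
    · by_cases hj : j = l
      · rw [hj]; exact not_lt.1 hi
      · rw [hne j hj]; exact hw.2.1 j hj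
    · exact mem_Cyl_mono hC hw.2.1 fun j hj => (hne j hj).ge
  · exact absurd ((le_add_unitVec w' l i).trans_lt hw.1) hi

theorem eq_of_adj_outerCells (hw : w ∈ outerCells μ i) (hw' : w' ∈ outerCells μ j)
    (h : boxGraph.Adj w w') : i = j := by
  obtain ⟨l, rfl | rfl⟩ := h
  · exact (eq_of_mem_outerCells_of_neg hw ((le_add_unitVec w l j).trans_lt hw'.1)).symm
  · exact eq_of_mem_outerCells_of_neg hw' ((le_add_unitVec w' l i).trans_lt hw.1)

end Cells

section Labels

variable {μ : Fin 3 → YoungDiagram} {A B : Set Box} {w w' : Box} {i j : Fin 3}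

/-- The cell `w` is an outer cell of sector `i`, or its component is given the label `i`. -/
def HasLabel (μ : Fin 3 → YoungDiagram) (A B : Set Box) (i : Fin 3) (w : Box) : Prop :=
  w ∈ outerCells μ i ∨ ∃ h : w ∈ labelledCells μ A B,
    ForcesLabel μ A B ((boxGraph.induce (labelledCells μ A B)).connectedComponentMk ⟨w, h⟩) i

theorem forcesLabel_mk_of_mem (h : w ∈ labelledCells μ A B)
    (hi : w ∈ CylNeg μ i ∪ RegionIIBar μ i) : ForcesLabel μ A B
      ((boxGraph.induce (labelledCells μ A B)).connectedComponentMk ⟨w, h⟩) i :=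
  ⟨⟨w, h⟩, rfl, hi⟩

theorem eq_of_forcesLabel (hns : ¬ BoxLabellingFails μ A B)
    {C : (boxGraph.induce (labelledCells μ A B)).ConnectedComponent}
    (hi : ForcesLabel μ A B C i) (hj : ForcesLabel μ A B C j) : i = j := by
  by_contra h
  exact hns ⟨C, i, j, h, hi, hj⟩

theorem HasLabel.unique (hns : ¬ BoxLabellingFails μ A B) (hi : HasLabel μ A B i w)
    (hj : HasLabel μ A B j w) : i = j := by
  rcases hi with hi | ⟨h, hi⟩ <;> rcases hj with hj | ⟨h', hj⟩
  · exact eq_of_mem_outerCells_of_neg hj hi.1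
  · exact absurd h' (outerCells_not_mem_labelledCells hi)
  · exact absurd h (outerCells_not_mem_labelledCells hj)
  · exact eq_of_forcesLabel hns hi hj

/-- Adjacent labelled cells share a component, and an outer cell forces its own sector on a labelled
neighbour; success of the algorithm excludes any second label. -/
theorem HasLabel.of_adj (hns : ¬ BoxLabellingFails μ A B)
    (hw' : w' ∈ solidB μ B \ solidA μ A) (h : boxGraph.Adj w w')
    (hi : HasLabel μ A B i w) : HasLabel μ A B i w' := by
  rcases mem_outerCells_or_mem_labelledCells hw' with ⟨j, hj⟩ | hL' <;> rcases hi with hi | ⟨hL, hi⟩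
  · rw [eq_of_adj_outerCells hi hj h]
    exact Or.inl hj
  · rw [eq_of_forcesLabel hns hi (forcesLabel_mk_of_mem hL (mem_of_adj_outerCells hj hL h.symm))]
    exact Or.inl hj
  · exact Or.inr ⟨hL', forcesLabel_mk_of_mem hL' (mem_of_adj_outerCells hi hL' h)⟩
  · refine Or.inr ⟨hL', ?_⟩
    have hadj : (boxGraph.induce (labelledCells μ A B)).Adj ⟨w, hL⟩ ⟨w', hL'⟩ := h
    rwa [← SimpleGraph.ConnectedComponent.sound hadj.reachable]

theorem stepInvariant_hasLabel (hns : ¬ BoxLabellingFails μ A B) (i : Fin 3) :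
    StepInvariant (solidA μ A) (solidB μ B) (HasLabel μ A B i) := fun _ l hw hw' =>
  propext ⟨HasLabel.of_adj hns hw ⟨l, Or.inr rfl⟩, HasLabel.of_adj hns hw' ⟨l, Or.inl rfl⟩⟩

/-! ### Sectors -/

theorem sub_eq_sub_of_proj_eq (h : proj w = proj w') (j l : Fin 3) :
    w j - w l = w' j - w' l := by
  have h1 := congrArg Prod.fst h
  have h2 := congrArg Prod.snd h
  simp only [proj] at h1 h2
  fin_cases j <;> fin_cases l <;> simp <;> omega

theorem proj_eq_of_sub_eq (h : ∀ j l, w j - w l = w' j - w' l) : proj w = proj w' :=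
  Prod.ext (h 0 2) (h 1 2)

theorem proj_mem_sectorPoints (h : ∀ j, w i ≤ w j) : proj w ∈ sectorPoints i :=
  ⟨fun j => w j - w i, proj_eq_of_sub_eq (by intros; ring), by simp, fun j => sub_nonneg.2 (h j)⟩

/-- Sector `i` is where coordinate `i` is minimal. On an outer cell it is strictly minimal, which
leaves room for one lattice step to any corner of `v`. -/
theorem mem_sector_of_outerCells {v : HexVertex} (hw : w ∈ outerCells μ i)
    (h : proj w ∈ v.corners) : v ∈ sector i := by
  have hlt : ∀ j, j ≠ i → w i < w j := fun j hj => hw.1.trans_le (hw.2.1 j hj)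
  intro r hr
  rcases exists_latticeVec_of_mem_corners h hr with rfl | ⟨l, rfl | hl⟩
  · refine proj_mem_sectorPoints fun j => ?_
    by_cases hj : j = i
    · rw [hj]
    · exact (hlt j hj).le
  · rw [← proj_add_unitVec]
    refine proj_mem_sectorPoints fun j => ?_
    by_cases hj : j = i
    · rw [hj]
    · have := hlt j hj
      have := le_add_unitVec w l j
      by_cases hl : l = i
      · subst hl; simp [unitVec, hj]; omega
      · simp [unitVec, Ne.symm hl] at *; omega
  · have : r = proj (w - unitVec l) := by
      rw [eq_comm, ← add_left_inj (latticeVec l), ← hl, ← proj_add_unitVec, sub_add_cancel]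
    rw [this]
    refine proj_mem_sectorPoints fun j => ?_
    by_cases hj : j = i
    · rw [hj]
    · have := hlt j hj
      by_cases hl : l = j
      · subst hl; simp [unitVec, Ne.symm hj]; omega
      · have := unitVec_nonneg l i
        simp [unitVec, Ne.symm hl] at *; omega

theorem eq_of_mem_sectorPoints (hw : w ∈ outerCells μ i) (h : proj w ∈ sectorPoints j) :
    j = i := by
  by_contra hj
  obtain ⟨w', hp, h0, hpos⟩ := h
  have := sub_eq_sub_of_proj_eq hp i j
  have := hpos i
  have := hw.1
  have := hw.2.1 j hj
  omega

end Labels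

/-! ### Paths of the superposition of two surfaces -/

section Paths

variable {J J' : Set Box} {H H' : LatticePoint → ℤ} {γ : ℤ → HexVertex}

theorem eventually_corners_not_mem (hγ : Function.Injective γ) {F : Set LatticePoint}
    (hF : F.Finite) : ∀ᶠ m in cofinite, ∀ p ∈ (γ m).corners, p ∉ F := by
  have : (⋃ p ∈ F, {v : HexVertex | p ∈ v.corners}).Finite :=
    hF.biUnion fun p _ => finite_setOf_mem_corners p
  refine (this.preimage hγ.injOn).subset fun m hm => ?_
  simp only [Set.mem_compl_iff, Set.mem_ofPred_eq, not_forall, not_not] at hm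
  obtain ⟨p, hp, hpF⟩ := hm
  exact Set.mem_biUnion hpF hp

theorem height_sub_le_add_one (hH : IsHeight J H) (hH' : IsHeight J' H') {v : HexVertex}
    {p q : LatticePoint} (hp : p ∈ v.corners) (hq : q ∈ v.corners) :
    H' p - H p ≤ H' q - H q + 1 := by
  rcases exists_latticeVec_of_mem_corners hp hq with rfl | ⟨i, rfl | rfl⟩
  · omega
  · have := hH.le_add p i
    have := hH'.sub_one_le p i
    omega
  · have := hH'.le_add q i
    have := hH.sub_one_le q i
    omega

theorem IsPath.exists_high_low (hH : IsHeight J H) (hH' : IsHeight J' H')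
    (hγ : IsPath (surfaceDimers J ⊔ surfaceDimers J') γ) (m : ℤ) :
    ∃ p q, (p ∈ (γ m).corners ∧ p ∈ (γ (m + 1)).corners) ∧
      (q ∈ (γ m).corners ∧ q ∈ (γ (m + 1)).corners) ∧ H' p - H p = H' q - H q + 1 := by
  -- After a doubled edge the path could only turn back to `γ m`, against injectivity.
  have hex : ¬ ((surfaceDimers J).Adj (γ m) (γ (m + 1)) ∧
      (surfaceDimers J').Adj (γ m) (γ (m + 1))) := by
    rintro ⟨h1, h2⟩
    have : γ m = γ (m + 1 + 1) := by
      rcases hγ.adj (m + 1) with h | h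
      · exact hH.adj_unique h1.symm h
      · exact hH'.adj_unique h2.symm h
    have := hγ.injective this
    omega
  have hcor : ∀ q i, (γ m = upAt q i ∧ γ (m + 1) = downAt q i ∨
      γ m = downAt q i ∧ γ (m + 1) = upAt q i) →
      (q ∈ (γ m).corners ∧ q ∈ (γ (m + 1)).corners) ∧
      (q + latticeVec i ∈ (γ m).corners ∧ q + latticeVec i ∈ (γ (m + 1)).corners) := by
    rintro q i (⟨h1, h2⟩ | ⟨h1, h2⟩) <;> simp [h1, h2, corners_upAt, corners_downAt]
  -- A square of `J` alone lowers `H` relative to `H'`, so `q + latticeVec i` is the high end; a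
  -- square of `J'` alone makes `q` the high end.
  rcases hγ.adj m with h | h
  · have h' : ¬ (surfaceDimers J').Adj (γ m) (γ (m + 1)) := fun h' => hex ⟨h, h'⟩
    rw [surfaceDimers_adj_iff] at h h'
    obtain ⟨q, i, hq, hqi⟩ := h
    have h1 := hH.hasSquare_iff.1 hq
    have h2 := hH'.of_not_hasSquare fun h => h' ⟨q, i, h, hqi⟩
    exact ⟨_, _, (hcor q i hqi).2, (hcor q i hqi).1, by omega⟩
  · have h' : ¬ (surfaceDimers J).Adj (γ m) (γ (m + 1)) := fun h' => hex ⟨h', h⟩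
    rw [surfaceDimers_adj_iff] at h h'
    obtain ⟨q, i, hq, hqi⟩ := h
    have h1 := hH'.hasSquare_iff.1 hq
    have h2 := hH.of_not_hasSquare fun h => h' ⟨q, i, h, hqi⟩
    exact ⟨_, _, (hcor q i hqi).1, (hcor q i hqi).2, by omega⟩

theorem eq_of_forall_succ_eq {α : Type*} {f : ℤ → α} (h : ∀ m, f (m + 1) = f m) (m n : ℤ) :
    f m = f n := by
  have key : ∀ m, f m = f 0 := fun m => by
    induction m using Int.induction_on with
    | zero => rfl
    | succ n ih => rw [h, ih]
    | pred n ih => rw [← ih, ← h, sub_add_cancel]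
  rw [key, key n]

/-- The top cells over neighbouring lattice points lie in the same part of `J' \ J`. -/
theorem StepInvariant.top_eq {α : Type*} {f : Box → α} (hf : StepInvariant J J' f)
    (hJ : IsLowerSet J) (hJ' : IsLowerSet J') (hH : IsHeight J H) (hH' : IsHeight J' H')
    {v : HexVertex} {p q : LatticePoint} (hp : p ∈ v.corners) (hq : q ∈ v.corners)
    (hpH : H p < H' p) (hqH : H q < H' q) :
    f (liftBox p (H' p)) = f (liftBox q (H' q)) := by
  have hmem : ∀ q, H q < H' q → liftBox q (H' q) ∈ J' \ J := fun q hq =>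
    ⟨(hH'.mem_iff _ _).2 le_rfl, fun h => absurd ((hH.mem_iff _ _).1 h) (not_le.2 hq)⟩
  have key : ∀ q i, H q < H' q → H (q + latticeVec i) < H' (q + latticeVec i) →
      f (liftBox (q + latticeVec i) (H' (q + latticeVec i))) = f (liftBox q (H' q)) := by
    intro q i h1 h2
    -- The two top boxes are comparable: with a square the second lies below the first, without one
    -- it is the first plus `unitVec i`.
    by_cases hs : HasSquare J' q i
    · refine (hf.eq_of_le hJ hJ' ?_ (hmem _ h2) (hmem _ h1)).symm
      rw [hH'.hasSquare_iff.1 hs]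
      exact liftBox_add_unitVec_sub_one_le q _ i
    · refine hf.eq_of_le hJ hJ' ?_ (hmem _ h1) (hmem _ h2)
      rw [hH'.of_not_hasSquare hs, ← liftBox_add_unitVec]
      exact le_add_of_nonneg_right (unitVec_nonneg i)
  rcases exists_latticeVec_of_mem_corners hp hq with rfl | ⟨i, rfl | rfl⟩
  · rfl
  · exact (key p i hpH hqH).symm
  · exact key q i hqH hpH

end Paths

/-! ### Successful labelling keeps each path in one sector at both ends -/

theorem pathsStartAndEndInSameSector_of_not_fails {μ : Fin 3 → YoungDiagram} {A B : Set Box}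
    (hAB : IsABConfiguration μ A B) (hns : ¬ BoxLabellingFails μ A B) :
    PathsStartAndEndInSameSector (doubleDimer μ A B) := by
  obtain ⟨H, hH⟩ := exists_isHeight_solidA hAB
  obtain ⟨H', hH'⟩ := exists_isHeight_solidB hAB
  intro γ hγ
  choose p q hp hq hpq using hγ.exists_high_low hH hH'
  have hfin := (finite_labelledCells hAB).image proj
  have hfar := eventually_corners_not_mem hγ.injective hfin
  -- The triangle `γ (m + 1)` contains the high and low points of both its path edges, and `H' - H`
  -- varies by at most one on it.
  have hconst : ∀ m n, H' (p m) - H (p m) = H' (p n) - H (p n) :=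
    eq_of_forall_succ_eq fun m => by
      have h1 := height_sub_le_add_one hH hH' (hp (m + 1)).1 (hq m).2
      have h2 := height_sub_le_add_one hH hH' (hp m).2 (hq (m + 1)).1
      have := hpq m
      have := hpq (m + 1)
      omega
  -- Far out `H ≤ H'` on the low side, hence `H < H'` on the high side, and `hconst` carries this
  -- along the whole path.
  have hpos : ∀ m, H (p m) < H' (p m) := by
    intro m
    obtain ⟨n, hn⟩ := hfar.exists
    have hqn : H (q n) ≤ H' (q n) := by
      by_contra! h
      refine hn (q n) (hq n).1 ⟨liftBox (q n) (H (q n)), ?_, proj_liftBox _ _⟩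
      exact mem_labelledCells_of_mem_solidA ((hH.mem_iff _ _).2 le_rfl)
        fun h' => absurd ((hH'.mem_iff _ _).1 h') (not_le.2 h)
    have := hconst m n
    have := hpq n
    omega
  have hlab : ∀ i m n, HasLabel μ A B i (liftBox (p m) (H' (p m))) =
      HasLabel μ A B i (liftBox (p n) (H' (p n))) := fun i =>
    eq_of_forall_succ_eq fun m => (stepInvariant_hasLabel hns i).top_eq (isLowerSet_solidA hAB)
      (isLowerSet_solidB hAB) hH hH' (hp (m + 1)).1 (hp m).2 (hpos _) (hpos _)
  have houter : ∀ᶠ m in cofinite, ∃ i, liftBox (p m) (H' (p m)) ∈ outerCells μ i := by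
    filter_upwards [hfar] with m hm
    refine (mem_outerCells_or_mem_labelledCells ⟨(hH'.mem_iff _ _).2 le_rfl, fun h =>
      absurd ((hH.mem_iff _ _).1 h) (not_le.2 (hpos m))⟩).resolve_right fun h => ?_
    exact hm (p m) (hp m).1 ⟨_, h, proj_liftBox _ _⟩
  obtain ⟨m₀, i, hi⟩ := houter.exists
  have hsec : ∀ᶠ m in cofinite, γ m ∈ sector i := by
    filter_upwards [houter] with m ⟨j, hj⟩
    have hij : j = i := HasLabel.unique hns (Or.inl hj) ((hlab i m₀ m).mp (Or.inl hi))
    subst hij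
    exact mem_sector_of_outerCells hj (by rw [proj_liftBox]; exact (hp m).1)
  rw [Int.cofinite_eq, eventually_sup] at hsec
  exact ⟨i, hsec.1, hsec.2⟩

/-! ### Failed labelling connects two sectors -/

section Failure

variable {μ : Fin 3 → YoungDiagram} {A B : Set Box} {f : Box → ℤ} {w w' : Box} {i : Fin 3}

/-- The outer cells of one sector are closed under joins, and each cell is linked to the join by a
monotone path. -/
theorem StepInvariant.eq_of_outerCells (hAB : IsABConfiguration μ A B)
    (hf : StepInvariant (solidA μ A) (solidB μ B) f) (hw : w ∈ outerCells μ i)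
    (hw' : w' ∈ outerCells μ i) : f w = f w' := by
  have hs : w ⊔ w' ∈ outerCells μ i :=
    ⟨max_lt hw.1 hw'.1, fun j hj => (hw.2.1 j hj).trans le_sup_left,
      fun h => hw.2.2 (mem_Cyl_mono h hw.2.1 fun j _ => le_sup_left)⟩
  have key : ∀ v ∈ outerCells μ i, v ≤ w ⊔ w' → f (w ⊔ w') = f v := fun v hv hle =>
    hf.eq_of_le (isLowerSet_solidA hAB) (isLowerSet_solidB hAB) hle (outerCells_subset hv)
      (outerCells_subset hs)
  rw [← key w hw le_sup_left, key w' hw' le_sup_right]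

/-- A cell of `CylNeg μ i` leaves the cylinder when its other coordinates are raised to at least
`N`; a cell of `RegionIIBar μ i` becomes outer when coordinate `i` is lowered to `-1`. -/
theorem StepInvariant.exists_outerCells_eq (hAB : IsABConfiguration μ A B)
    (hf : StepInvariant (solidA μ A) (solidB μ B) f) (hL : w ∈ labelledCells μ A B)
    (hw : w ∈ CylNeg μ i ∪ RegionIIBar μ i) :
    w ∈ solidB μ B \ solidA μ A ∧ ∃ w' ∈ outerCells μ i, f w = f w' := by
  have hA := isLowerSet_solidA hAB
  have hB := isLowerSet_solidB hAB
  rcases hw with hw | hw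
  · have hG := (labelledCells_subset hL).resolve_right fun h => h.2 (Or.inl hw.2)
    obtain ⟨N, hN0, hN⟩ := exists_cyl_bound μ
    have hv : (fun j => if j = i then w i else max (w j) N) ∈ outerCells μ i := by
      refine ⟨by simpa using neg_of_mem_CylNeg hw, fun j hj => ?_, fun h => ?_⟩
      · simp [hj, hN0]
      · have := hN i _ h (i + 1) (by simp)
        simp at this
    refine ⟨hG, _, hv, (hf.eq_of_le hA hB (fun j => ?_) hG (outerCells_subset hv)).symm⟩
    by_cases hj : j = i <;> simp [hj]
  · have ho := mem_octant_of_mem_RegionIIBar hw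
    have hG := (labelledCells_subset hL).resolve_right fun h =>
      not_mem_solidA_of_octant ho (fun h3 => hw.2 (Set.mem_iInter.1 h3 i)) h.1
    have hne : ∀ j, j ≠ i → Function.update w i (-1) j = w j := fun j hj => by simp [hj]
    have hv : Function.update w i (-1) ∈ outerCells μ i :=
      ⟨by simp, fun j hj => by rw [hne j hj]; exact ho j,
        fun h => hw.2 (mem_Cyl_mono h (fun j _ => ho j) fun j hj => (hne j hj).ge)⟩
    refine ⟨hG, _, hv, hf.eq_of_le hA hB (fun j => ?_) (outerCells_subset hv) hG⟩
    by_cases hj : j = i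
    · have := ho i
      subst hj; simp; omega
    · exact (hne j hj).le

/-- Cells of `solidA \ solidB` and `solidB \ solidA` are never adjacent, both solids being lower
sets, so a component of labelled cells stays in one of the two. -/
theorem StepInvariant.eq_of_reachable (hAB : IsABConfiguration μ A B)
    (hf : StepInvariant (solidA μ A) (solidB μ B) f) {x y : labelledCells μ A B}
    (h : (boxGraph.induce (labelledCells μ A B)).Reachable x y)
    (hx : (x : Box) ∈ solidB μ B \ solidA μ A) : f x = f y := by
  have hA := isLowerSet_solidA hAB
  have hB := isLowerSet_solidB hAB
  rw [SimpleGraph.reachable_iff_reflTransGen] at h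
  suffices h : (y : Box) ∈ solidB μ B \ solidA μ A ∧ f x = f y from h.2
  induction h with
  | refl => exact ⟨hx, rfl⟩
  | @tail y z _ hyz ih =>
    obtain ⟨hy, hxy⟩ := ih
    obtain ⟨l, hl | hl⟩ : boxGraph.Adj (y : Box) z := hyz
    · have hle : (y : Box) ≤ z := by rw [hl]; exact le_add_of_nonneg_right (unitVec_nonneg l)
      have hz := (labelledCells_subset z.2).resolve_right fun h => hy.2 (hA hle h.1)
      exact ⟨hz, hxy.trans (hf.eq_of_le hA hB hle hy hz).symm⟩
    · have hle : (z : Box) ≤ y := by rw [hl]; exact le_add_of_nonneg_right (unitVec_nonneg l)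
      have hz := (labelledCells_subset z.2).resolve_right fun h => h.2 (hB hle hy.1)
      exact ⟨hz, hxy.trans (hf.eq_of_le hA hB hle hz hy)⟩

/-- If the labelling fails, then the outer cells of two sectors are connected. -/
theorem BoxLabellingFails.exists_eq (hAB : IsABConfiguration μ A B)
    (hfail : BoxLabellingFails μ A B) : ∃ i j, i ≠ j ∧ ∀ f : Box → ℤ,
      StepInvariant (solidA μ A) (solidB μ B) f →
        ∀ w ∈ outerCells μ i, ∀ w' ∈ outerCells μ j, f w = f w' := by
  obtain ⟨C, i, j, hij, ⟨x, hxC, hx⟩, ⟨y, hyC, hy⟩⟩ := hfail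
  refine ⟨i, j, hij, fun f hf w hw w' hw' => ?_⟩
  obtain ⟨hxG, v, hv, hxv⟩ := hf.exists_outerCells_eq hAB x.2 hx
  obtain ⟨-, v', hv', hyv⟩ := hf.exists_outerCells_eq hAB y.2 hy
  have hxy := hf.eq_of_reachable hAB (SimpleGraph.ConnectedComponent.exact (hxC.trans hyC.symm)) hxG
  rw [hf.eq_of_outerCells hAB hw hv, hf.eq_of_outerCells hAB hw' hv', ← hxv, ← hyv, hxy]

end Failure

/-! ### Infinite orbits of two matchings and the potential of a path -/

section Orbits

variable {J J' : Set Box} {H H' : LatticePoint → ℤ}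

/-- An infinite orbit of the two matchings is a path that is closed under adjacency. -/
theorem exists_isPath_of_injective {e e' : LatticePoint ≃ LatticePoint}
    (he : ∀ p p', (surfaceDimers J).Adj (.up p) (.down p') ↔ p' = e p)
    (he' : ∀ p p', (surfaceDimers J').Adj (.up p) (.down p') ↔ p' = e' p)
    {u : ℤ → LatticePoint} (hu : Function.Injective u) (hstep : ∀ n, e (u (n + 1)) = e' (u n)) :
    ∃ γ, IsPath (surfaceDimers J ⊔ surfaceDimers J') γ ∧ (∀ n, γ (2 * n) = .up (u n)) ∧
      ∀ z t, (surfaceDimers J ⊔ surfaceDimers J').Adj (γ z) t → t ∈ Set.range γ := by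
  obtain ⟨γ, h0, h1⟩ : ∃ γ : ℤ → HexVertex, (∀ n, γ (2 * n) = .up (u n)) ∧
      ∀ n, γ (2 * n + 1) = .down (e' (u n)) := by
    refine ⟨fun z => if z % 2 = 0 then .up (u (z / 2)) else .down (e' (u (z / 2))),
      fun n => by simp, fun n => ?_⟩
    have e1 : (2 * n + 1) % 2 = 1 := by omega
    have e2 : (2 * n + 1) / 2 = n := by omega
    simp [e1, e2]
  refine ⟨γ, ⟨fun z z' h => ?_, fun z => ?_⟩, h0, fun z t ht => ?_⟩
  · obtain ⟨n, rfl | rfl⟩ := Int.even_or_odd' z <;> obtain ⟨n', rfl | rfl⟩ := Int.even_or_odd' z'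
    · simpa [h0, hu.eq_iff] using h
    · simp [h0, h1] at h
    · simp [h0, h1] at h
    · simpa [h1, hu.eq_iff] using h
  · obtain ⟨n, rfl | rfl⟩ := Int.even_or_odd' z
    · rw [h0, h1]
      exact Or.inr ((he' _ _).2 rfl)
    · rw [h1, show 2 * n + 1 + 1 = 2 * (n + 1) by ring, h0]
      exact Or.inl ((he _ _).2 (hstep n).symm).symm
  · obtain ⟨n, rfl | rfl⟩ := Int.even_or_odd' z
    · rw [h0] at ht
      rcases t with t | t
      · rcases ht with ht | ht <;> exact absurd ht surfaceDimers_not_adj_up_up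
      rcases ht with ht | ht
      · refine ⟨2 * (n - 1) + 1, ?_⟩
        rw [h1, ← hstep, sub_add_cancel, (he _ _).1 ht]
      · exact ⟨2 * n + 1, by rw [h1, (he' _ _).1 ht]⟩
    · rw [h1] at ht
      rcases t with t | t
      swap
      · rcases ht with ht | ht <;> exact absurd ht surfaceDimers_not_adj_down_down
      rcases ht with ht | ht
      · refine ⟨2 * (n + 1), ?_⟩
        rw [h0, e.injective ((hstep n).trans ((he _ _).1 ht.symm))]
      · exact ⟨2 * n, by rw [h0, e'.injective ((he' _ _).1 ht.symm)]⟩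

/-- A set `R` of vertices that is closed under adjacency in the superposition of two surfaces
gives a potential on the lattice whose jumps are those of the indicator function
of `{H < H'}` across the edges at the vertices in `R`. -/
theorem exists_potential_of_closed (hH : IsHeight J H) (hH' : IsHeight J' H')
    {R : Set HexVertex}
    (hR : ∀ s t, (surfaceDimers J ⊔ surfaceDimers J').Adj s t → s ∈ R → t ∈ R) :
    ∃ χ : LatticePoint → ℤ,
      (∀ q i, upAt q i ∉ R → χ (q + latticeVec i) = χ q) ∧
      (∀ q i, H q < H' q → H (q + latticeVec i) < H' (q + latticeVec i) →
        χ (q + latticeVec i) = χ q) ∧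
      ∀ q i, upAt q i ∈ R → H' q ≤ H q → H (q + latticeVec i) < H' (q + latticeVec i) →
        χ (q + latticeVec i) = χ q + 1 := by
  classical
  let g : LatticePoint → ℤ := fun q => if H q < H' q then 1 else 0
  -- Across a side whose dual edge is in neither matching `g` is constant; otherwise both ends of
  -- the edge lie in `R` or neither does. So the cochain can be read off from either adjacent
  -- triangle, and its sum vanishes round upward and downward triangles alike.
  have hdown : ∀ q i, (if upAt q i ∈ R then g (q + latticeVec i) - g q else 0) =
      if downAt q i ∈ R then g (q + latticeVec i) - g q else 0 := by
    intro q i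
    by_cases hD : (surfaceDimers J ⊔ surfaceDimers J').Adj (upAt q i) (downAt q i)
    · have : upAt q i ∈ R ↔ downAt q i ∈ R := ⟨hR _ _ hD, hR _ _ hD.symm⟩
      simp only [this]
    · have h1 := hH.of_not_hasSquare (q := q) (i := i) fun h =>
        hD (Or.inl (surfaceDimers_adj_iff.2 ⟨q, i, h, Or.inl ⟨rfl, rfl⟩⟩))
      have h2 := hH'.of_not_hasSquare (q := q) (i := i) fun h =>
        hD (Or.inr (surfaceDimers_adj_iff.2 ⟨q, i, h, Or.inl ⟨rfl, rfl⟩⟩))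
      have : g (q + latticeVec i) = g q := by simp [g, h1, h2]
      simp [this]
  obtain ⟨χ, hχ⟩ := exists_lattice_potential
    (c := fun q i => if upAt q i ∈ R then g (q + latticeVec i) - g q else 0) (by
      intro q i
      have e : i + 2 = i + 1 + 1 := by rw [add_assoc]; rfl
      have ec : q + latticeVec i + latticeVec (i + 1) + latticeVec (i + 2) = q := by
        rw [add_assoc q, add_assoc q, latticeVec_cycle, add_zero]
      have e2 := upAt_succ (q + latticeVec i) (i + 1)
      rw [← e, upAt_succ] at e2
      simp only [upAt_succ, e2, ec]
      split_ifs <;> ring) (by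
      intro q i
      have e : i + 1 = i + 2 + 2 := by rw [add_assoc]; rfl
      have ec : q + latticeVec i + latticeVec (i + 2) + latticeVec (i + 1) = q := by
        rw [add_assoc q, add_assoc q, add_right_comm, latticeVec_cycle, add_zero]
      have e2 := downAt_pred (q + latticeVec i) (i + 2)
      rw [← e, downAt_pred] at e2
      simp only [hdown]
      simp only [downAt_pred, e2, ec]
      split_ifs <;> ring)
  refine ⟨χ, fun q i h => ?_, fun q i h1 h2 => ?_, fun q i h h1 h2 => ?_⟩ <;>
    have h3 := hχ q i
  · simp only [h, if_false] at h3; omega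
  · simp only [g, h1, h2, if_true, sub_self, ite_self] at h3; omega
  · simp only [g, h, h2, not_lt.2 h1, if_true, if_false] at h3; omega

end Orbits

/-! ### Separation of consecutive sectors along their common axis -/

/-- The box with coordinates `a`, `b`, `c` in the directions `i`, `i + 1`, `i + 2`. -/
def cyclicBox (i : Fin 3) (a b c : ℤ) : Box :=
  fun l => if l = i then a else if l = i + 1 then b else c

section CyclicBox

variable (i : Fin 3) (a b c : ℤ)

@[simp] theorem cyclicBox_apply : cyclicBox i a b c i = a := by simp [cyclicBox]

@[simp] theorem cyclicBox_apply_add_one : cyclicBox i a b c (i + 1) = b := by simp [cyclicBox]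

@[simp] theorem cyclicBox_apply_add_two : cyclicBox i a b c (i + 2) = c := by simp [cyclicBox]

theorem cyclicBox_add_unitVec : cyclicBox i a b c + unitVec i = cyclicBox i (a + 1) b c := by
  funext l
  rcases Fin.eq_or_eq_add i l with rfl | rfl | rfl <;> simp [unitVec]

theorem cyclicBox_add_unitVec_add_one :
    cyclicBox i a b c + unitVec (i + 1) = cyclicBox i a (b + 1) c := by
  funext l
  rcases Fin.eq_or_eq_add i l with rfl | rfl | rfl <;> simp [unitVec]

theorem proj_cyclicBox_add (t : ℤ) :
    proj (cyclicBox i (a + t) (b + t) (c + t)) = proj (cyclicBox i a b c) := by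
  have h : ∀ l, cyclicBox i (a + t) (b + t) (c + t) l = cyclicBox i a b c l + t := fun l => by
    unfold cyclicBox; split_ifs <;> rfl
  refine proj_eq_of_sub_eq fun j l => ?_
  rw [h, h]
  ring

end CyclicBox

/-- If all paths stay in their sectors, then the outer cells of two consecutive sectors are separated
by the path that runs along the common axis inside the first one. -/
theorem exists_stepInvariant_ne {μ : Fin 3 → YoungDiagram} {A B : Set Box}
    (hAB : IsABConfiguration μ A B)
    (hP : PathsStartAndEndInSameSector (doubleDimer μ A B)) (i : Fin 3) :
    ∃ f : Box → ℤ, StepInvariant (solidA μ A) (solidB μ B) f ∧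
      ∃ w ∈ outerCells μ i, ∃ w' ∈ outerCells μ (i + 1), f w ≠ f w' := by
  obtain ⟨H, hH⟩ := exists_isHeight_solidA hAB
  obtain ⟨H', hH'⟩ := exists_isHeight_solidB hAB
  obtain ⟨e, he⟩ := hH.exists_matching
  obtain ⟨e', he'⟩ := hH'.exists_matching
  obtain ⟨N, hN0, hN⟩ := exists_cyl_bound μ
  have hpos : ∀ w ∈ solidB μ B \ solidA μ A, H (proj w) < H' (proj w) := by
    intro w hw
    have h1 := (hH'.mem_iff (proj w) (w 2)).1 (by rw [liftBox_proj]; exact hw.1)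
    have h2 := mt (hH.mem_iff (proj w) (w 2)).2 (by rw [liftBox_proj]; exact hw.2)
    omega
  let p : ℤ → LatticePoint := fun m => proj (cyclicBox i 0 0 m)
  have hp : Function.Injective p := fun m m' h => by
    simpa using sub_eq_sub_of_proj_eq h (i + 2) i
  have hpe : ∀ m t, proj (cyclicBox i t t (m + t)) = p m := fun m t => by
    simpa using proj_cyclicBox_add i 0 0 m t
  have hout : ∀ m, N < m → cyclicBox i (-1) 0 (m - 1) ∈ outerCells μ i := fun m hm => by
    refine ⟨by simp, fun j hj => ?_, fun h => ?_⟩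
    · rcases Fin.eq_or_eq_add i j with rfl | rfl | rfl
      · exact absurd rfl hj
      · simp
      · simp; omega
    · have := hN i _ h (i + 2) (by simp)
      simp at this
      omega
  have hout' : ∀ m, N < m → cyclicBox i 0 (-1) (m - 1) ∈ outerCells μ (i + 1) := fun m hm => by
    refine ⟨by simp, fun j hj => ?_, fun h => ?_⟩
    · rcases Fin.eq_or_eq_add i j with rfl | rfl | rfl
      · simp
      · exact absurd rfl hj
      · simp; omega
    · have := hN (i + 1) _ h (i + 2) (by simp)
      simp at this
      omega
  have hproj : ∀ m, proj (cyclicBox i (-1) 0 (m - 1)) = p m + latticeVec (i + 1) := fun m => by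
    rw [← hpe m (-1), ← proj_add_unitVec, cyclicBox_add_unitVec_add_one]
    rfl
  have hproj' : ∀ m, proj (cyclicBox i 0 (-1) (m - 1)) = p m + latticeVec i := fun m => by
    rw [← hpe m (-1), ← proj_add_unitVec, cyclicBox_add_unitVec]
    rfl
  -- Of two cylinders, one is not in direction `i + 2` and bounds that coordinate by `N`.
  have hoctant : ∀ m, N < m → cyclicBox i 0 0 m ∉ solidB μ B := by
    rintro m hm (h | ⟨h, -⟩)
    · refine h fun j => ?_
      rcases Fin.eq_or_eq_add i j with rfl | rfl | rfl
      · simp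
      · simp
      · simp; omega
    · obtain ⟨a, b, hab, ha, hb⟩ := mem_RegionII_union_RegionIII.1 h
      by_cases hai : i + 2 = a
      · have := hN b _ hb (i + 2) (by rw [hai]; exact hab)
        simp at this
        omega
      · have := hN a _ ha (i + 2) hai
        simp at this
        omega
  -- A box over `p m` has coordinates `(t, t, m + t)`: for `t < 0` two are negative and it lies in
  -- `solidA`; for `t ≥ 0` it lies above a box outside `solidB`.
  have haxis : ∀ m, N < m → H' (p m) ≤ H (p m) := by
    intro m hm
    by_contra! h
    set w := liftBox (p m) (H' (p m)) with hw
    have hB : w ∈ solidB μ B := (hH'.mem_iff _ _).2 le_rfl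
    have hA : w ∉ solidA μ A := fun hA => absurd ((hH.mem_iff _ _).1 hA) (not_le.2 h)
    have hwp : proj w = proj (cyclicBox i 0 0 m) := proj_liftBox _ _
    have h1 := sub_eq_sub_of_proj_eq hwp (i + 1) i
    have h2 := sub_eq_sub_of_proj_eq hwp (i + 2) i
    simp at h1 h2
    by_cases hneg : w i < 0
    · exact hA (Or.inl ⟨i, i + 1, by simp, hneg, by omega⟩)
    · refine hoctant m hm (isLowerSet_solidB hAB (fun j => ?_) hB)
      rcases Fin.eq_or_eq_add i j with rfl | rfl | rfl
      · simp; omega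
      · simp; omega
      · simp; omega
  obtain ⟨u, hu⟩ : ∃ u : ℤ → LatticePoint, ∀ m, upAt (p m) (i + 1) = .up (u m) :=
    ⟨_, fun _ => rfl⟩
  obtain ⟨d, hd⟩ : ∃ d : ℤ → LatticePoint, ∀ m, downAt (p m) (i + 1) = .down (d m) :=
    ⟨_, fun _ => rfl⟩
  have hu_inj : Function.Injective u := fun m m' h =>
    hp (upAt_injective (i + 1) (by simp only [hu, h]))
  have heu : ∀ m, N < m → e (u m) = d m := fun m hm => by
    refine ((he _ _).1 ?_).symm
    rw [← hu, ← hd]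
    refine surfaceDimers_adj_iff.2 ⟨p m, i + 1, ⟨cyclicBox i (-1) (-1) (m - 1),
      Or.inl ⟨i, i + 1, by simp, by simp, by simp⟩, hpe m (-1), ?_⟩, Or.inl ⟨rfl, rfl⟩⟩
    rw [cyclicBox_add_unitVec_add_one]
    exact (outerCells_subset (B := B) (hout m hm)).2
  have heu' : ∀ m, N < m → e' (u m) = d (m + 1) := fun m hm => by
    refine ((he' _ _).1 ?_).symm
    rw [← hu, ← hd]
    have hq : proj (cyclicBox i (-1) 0 m) + latticeVec i = p m := by
      rw [← proj_add_unitVec, cyclicBox_add_unitVec]; rfl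
    have hq' : proj (cyclicBox i (-1) 0 m) = p (m + 1) + latticeVec (i + 1) := by
      rw [← hproj, add_sub_cancel_right]
    refine surfaceDimers_adj_iff.2 ⟨proj (cyclicBox i (-1) 0 m), i, ⟨cyclicBox i (-1) 0 m,
      Or.inl (not_mem_octant_of_neg (i := i) (by simp)), rfl, ?_⟩, Or.inl ⟨?_, ?_⟩⟩
    · rw [cyclicBox_add_unitVec]
      exact hoctant m hm
    · rw [← upAt_succ _ i, hq]
    · rw [← downAt_pred, hq']
      congr 1
      rw [add_assoc]
      exact add_zero i
  -- Two steps along the path, from one upward triangle to the next; near the axis it takes `u m` to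
  -- `u (m + 1)`.
  let σ : Equiv.Perm LatticePoint := e'.trans e.symm
  have hσ : ∀ n : ℕ, (σ ^ n) (u (N + 1)) = u (N + 1 + n) := by
    intro n
    induction n with
    | zero => simp
    | succ n ih =>
      rw [pow_succ', Equiv.Perm.mul_apply, ih]
      simp only [σ, Equiv.trans_apply]
      rw [heu' _ (by omega), Equiv.symm_apply_eq, Nat.cast_succ, ← add_assoc, heu _ (by omega)]
  -- A repetition anywhere in the orbit would make it periodic, but its forward half runs off along
  -- the axis.
  have hσ_inj : Function.Injective fun n : ℤ => (σ ^ n) (u (N + 1)) := by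
    intro a b hab
    wlog hle : a ≤ b generalizing a b
    · exact (this hab.symm (by omega)).symm
    obtain ⟨n, rfl⟩ := Int.le.dest hle
    have h : (σ ^ n) (u (N + 1)) = u (N + 1) := by
      simp only [zpow_add, Equiv.Perm.mul_apply, EmbeddingLike.apply_eq_iff_eq] at hab
      rw [← zpow_natCast, ← hab]
    rw [hσ] at h
    have := hu_inj h
    omega
  obtain ⟨γ, hγ, hγu, hγc⟩ := exists_isPath_of_injective he he' hσ_inj fun n => by
    have : (σ ^ (n + 1)) (u (N + 1)) = σ ((σ ^ n) (u (N + 1))) := by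
      rw [add_comm, zpow_add, zpow_one, Equiv.Perm.mul_apply]
    simp only [this]
    simp [σ]
  have hγup : ∀ m, N < m → upAt (p m) (i + 1) ∈ Set.range γ := fun m hm => by
    obtain ⟨n, hn⟩ := Int.le.dest (show N + 1 ≤ m from hm)
    exact ⟨2 * n, by rw [hγu, zpow_natCast, hσ, hn, hu]⟩
  obtain ⟨l, hstart, hend⟩ := hP γ hγ
  obtain ⟨a, ha⟩ := eventually_atBot.1 hstart
  obtain ⟨b, hb⟩ := eventually_atTop.1 hend
  have hli : l = i := by
    have hs := hb (2 * (b.toNat : ℤ)) (by omega)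
    rw [hγu, zpow_natCast, hσ, ← hu] at hs
    refine eq_of_mem_sectorPoints (hout (N + 1 + b.toNat) (by omega)) (hs ?_)
    rw [hproj, corners_upAt]
    simp
  subst hli
  -- These triangles have a corner under an outer cell of sector `l + 1`, so they are not in sector
  -- `l`, and the path meets only finitely many of them.
  obtain ⟨m, hm, hmγ⟩ : ∃ m, N < m ∧ upAt (p m) l ∉ Set.range γ := by
    by_contra! h
    refine Set.Ioi_infinite N ((((Set.finite_Ioo a b).image γ).preimage
      ((upAt_injective l).comp hp).injOn).subset fun m hm => ?_)
    obtain ⟨z, hz⟩ := h m hm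
    have hns : γ z ∉ sector l := fun hs => by
      have := eq_of_mem_sectorPoints (hout' m hm) (hs (by
        rw [hz, hproj', corners_upAt]
        simp))
      simp at this
    refine ⟨z, ⟨?_, ?_⟩, hz⟩
    · by_contra! hza
      exact hns (ha z hza)
    · by_contra! hzb
      exact hns (hb z hzb)
  obtain ⟨χ, hχ₀, hχ₁, hχ₂⟩ := exists_potential_of_closed hH hH' (R := Set.range γ) (by
    rintro s t hst ⟨z, rfl⟩
    exact hγc z t hst)
  refine ⟨fun w => χ (proj w), fun w j hw hw' => ?_, _, hout m hm, _, hout' m hm, ?_⟩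
  · have h := hpos _ hw'
    simp only [proj_add_unitVec] at h ⊢
    exact hχ₁ _ _ (hpos w hw) h
  -- From the axis point `p m` the potential jumps by one into sector `l`, across the path, and not
  -- at all into sector `l + 1`.
  · have h := hpos _ (outerCells_subset (hout m hm))
    simp only [hproj, hproj'] at h ⊢
    rw [hχ₀ _ _ hmγ, hχ₂ _ _ (hγup m hm) (haxis m hm) h]
    omega

theorem not_fails_of_pathsStartAndEndInSameSector {μ : Fin 3 → YoungDiagram} {A B : Set Box}
    (hAB : IsABConfiguration μ A B)
    (hP : PathsStartAndEndInSameSector (doubleDimer μ A B)) : ¬ BoxLabellingFails μ A B := by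
  intro hfail
  obtain ⟨i, j, hij, heq⟩ := hfail.exists_eq hAB
  -- Any two of the three sectors are consecutive in one of the two orders.
  obtain rfl | rfl : j = i + 1 ∨ i = j + 1 := by
    exact (by decide : ∀ i j : Fin 3, i ≠ j → j = i + 1 ∨ i = j + 1) i j hij
  · obtain ⟨f, hf, w, hw, w', hw', hne⟩ := exists_stepInvariant_ne hAB hP i
    exact hne (heq f hf w hw w' hw')
  · obtain ⟨f, hf, w, hw, w', hw', hne⟩ := exists_stepInvariant_ne hAB hP j
    exact hne (heq f hf w' hw' w hw).symm

theorem theorem2 (μ : Fin 3 → YoungDiagram) (A B : Set Box) (hAB : IsABConfiguration μ A B) :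
    IsLabelledABConfiguration μ A B ↔
      PathsStartAndEndInSameSector (doubleDimer μ A B) :=
  ⟨fun h => pathsStartAndEndInSameSector_of_not_fails hAB h.2,
    fun h => ⟨hAB, not_fails_of_pathsStartAndEndInSameSector hAB h⟩⟩
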